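/- **Setting.** Let $\Sigma$ be an infinite set of node labels with a total order and a least element; comparing two labels and obtaining the least label take constant time. A *tree* is a finite rooted unranked tree whose nodes are labelled by $\Sigma$; a *decorated tree* is a tree $t$ with a selected node $\mathit{sel}_t$ other than the root. A *unary twig query* $q$ is a finite rooted tree whose nodes are labelled by $\Sigma\cup\{\star\}$, each of whose edges is either a child edge or a descendant edge, with a selecting node $\mathit{sel}_q$ other than the root. An *embedding* of $q$ in $t$ is a (not necessarily injective) map from the nodes of $q$ to the nodes of $t$ that maps root to root and $\mathit{sel}_q$ to $\mathit{sel}_t$, maps each child edge to a parent-child pair, maps each descendant edge to a pair (node, proper descendant), and sends each node with label $a\in\Sigma$ to a node with label $a$ (nodes labelled $\star$ are unrestricted). The language $\mathcal L_1(q)$ is the set of decorated trees in which $q$ embeds; two queries are *equivalent* if they have the same language. Sizes of trees and queries are numbers of nodes. A path, taken as a query from its first node (root) to its last node (leaf), is *anchored as a unary path query* if no descendant edge on it is incident to a $\star$-node other than its root and its leaf; it is *anchored as a Boolean path query* if, moreover, in case its leaf is labelled $\star$, the edge leading to the leaf (if any) is a descendant edge. A unary twig query $q$ is *path-subsumption-free*,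 $q\in\mathit{PsfTwig}_1$, if the path from the root to $\mathit{sel}_q$ is anchored as a unary path query and, for every leaf $v\neq\mathit{sel}_q$, the path to $v$ from the closest ancestor-or-self of $v$ on the path from the root to $\mathit{sel}_q$ is anchored as a Boolean path query. A *sample* is a finite nonempty set $S$ of decorated trees; its size is the sum of the sizes of its elements; it is *consistent* with $q$ if $S\subseteq\mathcal L_1(q)$. **Theorem.** The class $\mathit{PsfTwig}_1$ is learnable in polynomial time and data from positive examples. That is, there are an algorithm $\mathsf{learner}$, which takes a sample $S$ (given as a list of its elements, in any order) and returns a query of $\mathit{PsfTwig}_1$ or a special value Null, and a polynomial $\mathit{poly}$ such that 1. (*Polynomial time.*) the running time of $\mathsf{learner}(S)$ is polynomially bounded in the size of $S$; 2. (*Soundness.*) for every sample $S$, $\mathsf{learner}(S)$ is a query in $\mathit{PsfTwig}_1$ consistent with $S$, or Null if there is no such query; 3. (*Completeness.*) for every $q\in\mathit{PsfTwig}_1$ there is a sample $\mathit{CS}_q\subseteq\mathcal L_1(q)$ of size at most $\mathit{poly}(|q|)$ such that for every sample $S$ with $\mathit{CS}_q\subseteq S\subseteq\mathcal L_1(q)$,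 $\mathsf{learner}(S)$ is a query equivalent to $q$. -/

import Mathlib

universe u

/-! ## Trees -/

/-- Finite node-labelled unranked trees, written as terms. The nodes of a tree are the addresses
of its subterms; the order of the children plays no role in the semantics of queries. -/
inductive LTree (A : Type u) : Type u
  | node (label : A) (children : List (LTree A)) : LTree A

namespace LTree

variable {A : Type u}

def label : LTree A → A
  | node a _ => a

/-- The subtree at an address, if the address exists in the tree. -/
def subAt : LTree A → List ℕ → Option (LTree A)
  | t, [] => some t
  | node _ ts, i :: p =>
    match ts[i]? with
    | none => none
    | some t => t.subAt p

/-- The set of nodes. -/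
def Node (t : LTree A) : Type := {p : List ℕ // (t.subAt p).isSome = true}

def root (t : LTree A) : t.Node := ⟨[], by simp [subAt]⟩

def lab (t : LTree A) (n : t.Node) : A := ((t.subAt n.1).get n.2).label

/-- The parent-child relation: `n'` is a child of `n`. -/
def Child (t : LTree A) (n n' : t.Node) : Prop := ∃ i, n'.1 = n.1 ++ [i]

/-- The number of nodes. -/
def size : LTree A → ℕ
  | node _ ts => 1 + (ts.map size).sum

end LTree

/-- Decorated trees: the selected node is not the root. -/
structure DecTree (A : Type u) : Type u where
  tree : LTree A
  sel : tree.Node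
  sel_ne_root : sel ≠ tree.root

/-! ## Twig queries -/

/-- The two kinds of query edges. -/
inductive Axis : Type
  | child
  | desc

/-- Boolean twig queries. The label `none` is the wildcard, and every child comes with the kind of
the edge that leads to it. -/
inductive Twig (A : Type u) : Type u
  | node (label : Option A) (children : List (Axis × Twig A)) : Twig A

namespace Twig

variable {A : Type u}

def label : Twig A → Option A
  | node a _ => a

def children : Twig A → List (Axis × Twig A)
  | node _ cs => cs

/-- The subquery at an address, if the address exists in the query. -/
def subAt : Twig A → List ℕ → Option (Twig A)
  | q, [] => some q
  | node _ cs, i :: p =>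
    match cs[i]? with
    | none => none
    | some c => c.2.subAt p

/-- The set of nodes. -/
def Node (q : Twig A) : Type := {p : List ℕ // (q.subAt p).isSome = true}

def root (q : Twig A) : q.Node := ⟨[], by simp [subAt]⟩

def lab (q : Twig A) (n : q.Node) : Option A := ((q.subAt n.1).get n.2).label

/-- `q.Edge k n n'`: there is an edge of kind `k` from `n` to `n'`. -/
def Edge (q : Twig A) (k : Axis) (n n' : q.Node) : Prop :=
  ∃ i c, n'.1 = n.1 ++ [i] ∧ ((q.subAt n.1).get n.2).children[i]? = some (k, c)

/-- `n` is `n'` or one of its ancestors. -/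
def AncOrSelf (q : Twig A) (n n' : q.Node) : Prop := n.1 <+: n'.1

/-- A leaf has no outgoing edge. -/
def IsLeaf (q : Twig A) (n : q.Node) : Prop := ∀ k n', ¬ q.Edge k n n'

/-- The number of nodes. -/
def size : Twig A → ℕ
  | node _ cs => 1 + (cs.map fun c => c.2.size).sum
decreasing_by
  rename_i h
  have h1 := List.sizeOf_lt_of_mem h
  rcases c with ⟨k, c⟩
  simp at h1 ⊢
  omega

end Twig

/-- Unary twig queries: the selecting node is not the root. -/
structure UTwig (A : Type u) : Type u where
  twig : Twig A
  sel : twig.Node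
  sel_ne_root : sel ≠ twig.root

/-! ## Semantics -/

/-- A tree label matches a query label if the latter is the wildcard or the same label. -/
def LabelMatches {A : Type u} (a : A) (l : Option A) : Prop := ∀ b, l = some b → a = b

/-- Embeddings of a unary twig query in a decorated tree. -/
structure IsEmbedding {A : Type u} (q : UTwig A) (t : DecTree A)
    (f : q.twig.Node → t.tree.Node) : Prop where
  root : f q.twig.root = t.tree.root
  child : ∀ n n', q.twig.Edge Axis.child n n' → t.tree.Child (f n) (f n')
  desc : ∀ n n', q.twig.Edge Axis.desc n n' → Relation.TransGen t.tree.Child (f n) (f n')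
  lab : ∀ n, LabelMatches (t.tree.lab (f n)) (q.twig.lab n)
  sel : f q.sel = t.sel

/-- The language of a unary twig query. -/
def UTwig.lang {A : Type u} (q : UTwig A) : Set (DecTree A) := {t | ∃ f, IsEmbedding q t f}

/-! ## Anchored paths and path-subsumption-free queries -/

namespace Twig

variable {A : Type u}

/-- The path of `q` from `u` down to `v`, taken as a path query with root `u` and leaf `v`, has no
descendant edge incident to a wildcard node other than its root and its leaf. -/
def AnchoredUnary (q : Twig A) (u v : q.Node) : Prop :=
  ∀ n n', q.AncOrSelf u n → q.AncOrSelf n' v → q.Edge Axis.desc n n' →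
    (q.lab n = none → n = u) ∧ (q.lab n' = none → n' = v)

/-- The Boolean variant requires moreover that a wildcard leaf is not reached by a child edge. -/
def AnchoredBoolean (q : Twig A) (u v : q.Node) : Prop :=
  q.AnchoredUnary u v ∧
    (q.lab v = none → ∀ n, q.AncOrSelf u n → ¬ q.Edge Axis.child n v)

end Twig

namespace UTwig

variable {A : Type u}

/-- The nodes on the path from the root to the selecting node. -/
def OnSelPath (q : UTwig A) (n : q.twig.Node) : Prop := q.twig.AncOrSelf n q.sel

/-- `u` is the closest ancestor-or-self of `v` on the selecting path. -/
def IsBranchNode (q : UTwig A) (u v : q.twig.Node) : Prop :=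
  q.OnSelPath u ∧ q.twig.AncOrSelf u v ∧
    ∀ w, q.OnSelPath w → q.twig.AncOrSelf w v → q.twig.AncOrSelf w u

/-- Unary path-subsumption-free twig queries. -/
def IsPsf (q : UTwig A) : Prop :=
  q.twig.AnchoredUnary q.twig.root q.sel ∧
    ∀ u v, q.twig.IsLeaf v → v ≠ q.sel → q.IsBranchNode u v → q.twig.AnchoredBoolean u v

end UTwig

/-! ## The computation model

First-order functional programs over binary trees of data whose leaves may hold labels. Labels are
atomic: the only operations on them are the comparison of two labels and access to the least
label, each at constant cost. Apart from that every operation pays for the sizes of the data that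
it reads and writes, so that no datum produced during a run is larger than the cost of the run. -/

/-- Data: binary trees whose leaves are empty or hold a label. -/
inductive Val (A : Type u) : Type u
  | nil : Val A
  | atom (a : A) : Val A
  | pair (x y : Val A) : Val A

namespace Val

variable {A : Type u}

def size : Val A → ℕ
  | nil => 1
  | atom _ => 1
  | pair x y => x.size + y.size + 1

def fst : Val A → Val A
  | pair x _ => x
  | _ => nil

def snd : Val A → Val A
  | pair _ y => y
  | _ => nil

/-- The empty datum stands for false, every other datum for true. -/
def ofBool : Bool → Val A
  | false => nil
  | true => pair nil nil

def isPair : Val A → Bool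
  | pair _ _ => true
  | _ => false

def isAtom : Val A → Bool
  | atom _ => true
  | _ => false

/-- The comparison of two labels. -/
def le [LinearOrder A] : Val A → Bool
  | pair (atom a) (atom b) => decide (a ≤ b)
  | _ => false

/-- Numbers in unary. -/
def ofNat : ℕ → Val A
  | 0 => nil
  | n + 1 => pair nil (ofNat n)

def ofList : List (Val A) → Val A
  | [] => nil
  | x :: l => pair x (ofList l)

end Val

/-- The basic operations. -/
inductive Op : Type
  | id
  | nil
  | least
  | fst
  | snd
  | isPair
  | isAtom
  | le

def Op.apply {A : Type u} [LinearOrder A] [OrderBot A] : Op → Val A → Val A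
  | .id, v => v
  | .nil, _ => Val.nil
  | .least, _ => Val.atom ⊥
  | .fst, v => v.fst
  | .snd, v => v.snd
  | .isPair, v => Val.ofBool v.isPair
  | .isAtom, v => Val.ofBool v.isAtom
  | .le, v => Val.ofBool v.le

/-- Programs; each one denotes a partial function from data to data.
`comp f g` runs `g` and then `f`. The program `fix f` runs `f` as the body of a recursive
function, and `call` is a call of the innermost enclosing recursive function. -/
inductive Prog : Type
  | op (o : Op)
  | pair (f g : Prog)
  | comp (f g : Prog)
  | ite (c f g : Prog)
  | fix (f : Prog)
  | call

/-- `Runs r f v w n`: with `r` as the body of the enclosing recursive function, the program `f`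
started on `v` halts with the result `w` at the cost `n`. -/
inductive Runs {A : Type u} [LinearOrder A] [OrderBot A] :
    Prog → Prog → Val A → Val A → ℕ → Prop
  | op (r : Prog) (o : Op) (v : Val A) : Runs r (.op o) v (o.apply v) (v.size + (o.apply v).size)
  | pair {r f g : Prog} {v x y : Val A} {m n : ℕ} :
      Runs r f v x m → Runs r g v y n → Runs r (.pair f g) v (.pair x y) (v.size + m + n + 1)
  | comp {r f g : Prog} {v x y : Val A} {m n : ℕ} :
      Runs r g v x m → Runs r f x y n → Runs r (.comp f g) v y (v.size + m + n + 1)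
  | ite_true {r c f g : Prog} {v b x : Val A} {m n : ℕ} :
      Runs r c v b m → b ≠ .nil → Runs r f v x n → Runs r (.ite c f g) v x (v.size + m + n + 1)
  | ite_false {r c f g : Prog} {v b x : Val A} {m n : ℕ} :
      Runs r c v b m → b = .nil → Runs r g v x n → Runs r (.ite c f g) v x (v.size + m + n + 1)
  | fix {r f : Prog} {v x : Val A} {n : ℕ} :
      Runs f f v x n → Runs r (.fix f) v x (v.size + n + 1)
  | call {r : Prog} {v x : Val A} {n : ℕ} :
      Runs r r v x n → Runs r .call v x (v.size + n + 1)

/-- `P` halts on `v` with the result `w` at the cost `n`. -/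
def Prog.Computes {A : Type u} [LinearOrder A] [OrderBot A] (P : Prog) (v w : Val A) (n : ℕ) :
    Prop :=
  Runs P P v w n

/-- Programs are deterministic. -/
theorem Runs.unique {A : Type u} [LinearOrder A] [OrderBot A] {r f : Prog} {v w w' : Val A}
    {n n' : ℕ} (h : Runs r f v w n) (h' : Runs r f v w' n') : w = w' ∧ n = n' := by
  induction h generalizing w' n' with
  | op => cases h'; exact ⟨rfl, rfl⟩
  | pair _ _ ih1 ih2 =>
    cases h' with
    | pair a b =>
      obtain ⟨rfl, rfl⟩ := ih1 a
      obtain ⟨rfl, rfl⟩ := ih2 b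
      exact ⟨rfl, rfl⟩
  | comp _ _ ih1 ih2 =>
    cases h' with
    | comp a b =>
      obtain ⟨rfl, rfl⟩ := ih1 a
      obtain ⟨rfl, rfl⟩ := ih2 b
      exact ⟨rfl, rfl⟩
  | ite_true _ hb _ ih1 ih2 =>
    cases h' with
    | ite_true a _ b =>
      obtain ⟨rfl, rfl⟩ := ih1 a
      obtain ⟨rfl, rfl⟩ := ih2 b
      exact ⟨rfl, rfl⟩
    | ite_false a hb' _ => exact absurd ((ih1 a).1.trans hb') hb
  | ite_false _ hb _ ih1 ih2 =>
    cases h' with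
    | ite_true a hb' _ => exact absurd ((ih1 a).1.symm.trans hb) hb'
    | ite_false a _ b =>
      obtain ⟨rfl, rfl⟩ := ih1 a
      obtain ⟨rfl, rfl⟩ := ih2 b
      exact ⟨rfl, rfl⟩
  | fix _ ih =>
    cases h' with
    | fix a =>
      obtain ⟨rfl, rfl⟩ := ih a
      exact ⟨rfl, rfl⟩
  | call _ ih =>
    cases h' with
    | call a =>
      obtain ⟨rfl, rfl⟩ := ih a
      exact ⟨rfl, rfl⟩

/-! ## Encodings -/

def LTree.encode {A : Type u} : LTree A → Val A
  | node a ts => .pair (.atom a) (.ofList (ts.map LTree.encode))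

/-- The address of a node. -/
def encodeAddress {A : Type u} (p : List ℕ) : Val A := .ofList (p.map Val.ofNat)

def DecTree.encode {A : Type u} (t : DecTree A) : Val A :=
  .pair t.tree.encode (encodeAddress t.sel.1)

def encodeLabel {A : Type u} : Option A → Val A
  | none => .nil
  | some a => .atom a

/-- A child edge is written as false, a descendant edge as true. -/
def Axis.encode {A : Type u} : Axis → Val A
  | .child => .ofBool false
  | .desc => .ofBool true

def Twig.encode {A : Type u} : Twig A → Val A
  | node l cs => .pair (encodeLabel l) (.ofList (cs.map fun c => .pair c.1.encode c.2.encode))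
decreasing_by
  rename_i h
  have h1 := List.sizeOf_lt_of_mem h
  rcases c with ⟨k, c⟩
  simp at h1 ⊢
  omega

def UTwig.encode {A : Type u} (q : UTwig A) : Val A :=
  .pair q.twig.encode (encodeAddress q.sel.1)

/-- `none` is the special value Null. -/
def encodeAnswer {A : Type u} {Q : Type u} (e : Q → Val A) : Option Q → Val A
  | none => .nil
  | some q => .pair .nil (e q)

/-! ## Learnability -/

/-- A learning setting: examples, queries and the semantics of queries, together with the sizes
and the machine encodings of examples and queries. -/
structure LearningSetting (A : Type u) where
  Example : Type u
  Query : Type u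
  lang : Query → Set Example
  exampleSize : Example → ℕ
  querySize : Query → ℕ
  encodeExample : Example → Val A
  encodeQuery : Query → Val A

namespace LearningSetting

variable {A : Type u} (K : LearningSetting A)

/-- The size of a sample is the sum of the sizes of its examples. -/
def sampleSize (S : Finset K.Example) : ℕ := ∑ t ∈ S, K.exampleSize t

/-- `S` is consistent with `q`. -/
def Consistent (S : Finset K.Example) (q : K.Query) : Prop := ∀ t ∈ S, t ∈ K.lang q

/-- `l` lists the elements of `S`, each one once. -/
def Lists (l : List K.Example) (S : Finset K.Example) : Prop := l.Nodup ∧ ∀ t, t ∈ l ↔ t ∈ S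

def encodeList (l : List K.Example) : Val A := .ofList (l.map K.encodeExample)

/-- On the input that lists the examples in `l`, the program `P` returns the answer `o`. -/
def Returns [LinearOrder A] [OrderBot A] (P : Prog) (l : List K.Example) (o : Option K.Query) :
    Prop :=
  ∃ n, P.Computes (K.encodeList l) (encodeAnswer K.encodeQuery o) n

/-- Halting within a time that is polynomial in the size of the sample. -/
def RunsInPolyTime [LinearOrder A] [OrderBot A] (P : Prog) : Prop :=
  ∃ p : Polynomial ℕ, ∀ (S : Finset K.Example) (l : List K.Example), S.Nonempty → K.Lists l S →
    ∃ w n, P.Computes (K.encodeList l) w n ∧ n ≤ p.eval (K.sampleSize S)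

/-- For every sample the answer is a consistent query, or Null if there is none. -/
def Sound [LinearOrder A] [OrderBot A] (P : Prog) : Prop :=
  ∀ (S : Finset K.Example) (l : List K.Example), S.Nonempty → K.Lists l S →
    (∃ q, K.Returns P l (some q) ∧ K.Consistent S q) ∨
      (K.Returns P l none ∧ ¬ ∃ q, K.Consistent S q)

/-- Every query has a characteristic sample of polynomial size. -/
def Complete [LinearOrder A] [OrderBot A] (P : Prog) : Prop :=
  ∃ p : Polynomial ℕ, ∀ q : K.Query, ∃ C : Finset K.Example,
    C.Nonempty ∧ K.Consistent C q ∧ K.sampleSize C ≤ p.eval (K.querySize q) ∧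
      ∀ (S : Finset K.Example) (l : List K.Example), C ⊆ S → K.Consistent S q → K.Lists l S →
        ∃ q', K.Returns P l (some q') ∧ K.lang q' = K.lang q

/-- Learnability in polynomial time and data. -/
def LearnableInPolyTimeAndData [LinearOrder A] [OrderBot A] : Prop :=
  ∃ P : Prog, K.RunsInPolyTime P ∧ K.Sound P ∧ K.Complete P

end LearningSetting

/-- The setting of unary path-subsumption-free twig queries and positive examples. -/
def psfTwigOne (A : Type u) : LearningSetting A where
  Example := DecTree A
  Query := {q : UTwig A // q.IsPsf}
  lang q := q.1.lang
  exampleSize t := t.tree.size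
  querySize q := q.1.twig.size
  encodeExample t := t.encode
  encodeQuery q := q.1.encode

/-! ## Polynomial-time computable functions -/

/-! The learner enumerates candidate queries and picks a least one. A tree is identified with a
query without wildcards and descendant edges (`LTree.toTwig`). Membership in a language then means
existence of a homomorphism of queries (`mem_lang_iff`), homomorphisms compose, and two queries with
homomorphisms in both directions are equivalent.

The characteristic sample of `q` consists of two canonical trees of `q`. In the first, descendant
edges become single edges and wildcards get a label `z'`. In the second, descendant edges become
paths with `|q|` inner nodes labelled by a fresh `y`, and wildcards get a fresh label `z`. The heart
of the proof is `Twig.hom_of_hom_canon`: every path-subsumption-free `q'` that embeds in both trees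
has a homomorphism to `q`. The first tree shows that `y` and `z` do not occur in `q'` and that `q'`
has depth less than `|q|`. In the second tree, a node of `q'` that lands inside a `y`-path must be a
wildcard. Unless it is a leaf off the selecting path, path-subsumption-freeness forces child edges
above and below it until the whole `y`-path is covered, which is longer than `q'` is deep. The
exceptional leaves are reached by descendant edges, so their images can be pushed down to the end of
the path. What results is a homomorphism to `q`.

Conversely, `q` itself can be recovered from the second tree by guessing `y` and `z`, contracting
the nodes labelled `y` and turning `z` into the wildcard (`Twig.read_canon`). Trying all pairs of
labels and all selecting nodes for every sample tree gives polynomially many candidates. Those that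
are path-subsumption-free and consistent all map to `q`, and `q` is one of them; hence any candidate
to which all the others map is equivalent to `q`. If no such candidate exists, the answer is the
universal query, which is path-subsumption-free and consistent with every sample, so Null is never
needed.

For polynomial time, `Comp` is closed under the usual combinators and under a controlled recursion
over forests (`Comp.forest`). Homomorphisms are found by iterated refinement of a relation between
nodes (`isHom_iff`), and path-subsumption-freeness is tested edge by edge (`UTwig.isPsf_iff`). -/

theorem Polynomial.eval_nat_mono (p : Polynomial ℕ) : Monotone fun n => p.eval n := by
  intro a b hab
  simp only [Polynomial.eval_eq_sum_range]
  gcongr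

theorem Val.size_pos {A : Type u} (v : Val A) : 0 < v.size := by
  cases v <;> simp [Val.size]

/-- Every rule charges for what it writes. A time bound is therefore also a bound on the result,
which is what makes the composition of two polynomial-time programs polynomial. -/
theorem Runs.size_le {A : Type u} [LinearOrder A] [OrderBot A] {r f : Prog} {v w : Val A} {n : ℕ}
    (h : Runs r f v w n) : w.size ≤ n := by
  induction h with
  | pair => simp only [Val.size]; omega
  | _ => omega

/-- Types whose elements are represented by data. -/
class Enc (A : Type u) (α : Type*) where
  enc : α → Val A

open Enc (enc)

/-- The size of the representation. -/
abbrev esize (A : Type u) {α : Type*} [Enc A α] (x : α) : ℕ := (enc x : Val A).size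

section Instances

variable {A : Type u}

instance : Enc A (Val A) := ⟨id⟩
instance : Enc A Unit := ⟨fun _ => .nil⟩
instance : Enc A Bool := ⟨Val.ofBool⟩
instance : Enc A ℕ := ⟨Val.ofNat⟩
instance : Enc A Axis := ⟨Axis.encode⟩
instance : Enc A (Option A) := ⟨encodeLabel⟩
instance : Enc A (LTree A) := ⟨LTree.encode⟩
instance : Enc A (Twig A) := ⟨Twig.encode⟩
instance {α β : Type*} [Enc A α] [Enc A β] : Enc A (α × β) := ⟨fun x => .pair (enc x.1) (enc x.2)⟩
instance {α : Type*} [Enc A α] : Enc A (List α) := ⟨fun l => .ofList (l.map enc)⟩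

variable {α β : Type*} [Enc A α] [Enc A β]

theorem enc_mk (x : α) (y : β) : (enc (x, y) : Val A) = .pair (enc x) (enc y) := rfl

theorem enc_cons (x : α) (l : List α) : (enc (x :: l) : Val A) = .pair (enc x) (enc l) := rfl

theorem esize_pos (x : α) : 0 < esize A x := Val.size_pos _

theorem esize_mk (x : α) (y : β) : esize A (x, y) = esize A x + esize A y + 1 := rfl

theorem esize_nil : esize A ([] : List α) = 1 := rfl

theorem esize_cons (x : α) (l : List α) : esize A (x :: l) = esize A x + esize A l + 1 := rfl

theorem esize_append (l l' : List α) : esize A (l ++ l') + 1 = esize A l + esize A l' := by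
  induction l with
  | nil => rw [List.nil_append, esize_nil]; omega
  | cons x l ih => rw [List.cons_append, esize_cons, esize_cons]; omega

end Instances

/-- Functions that are computed by a program in polynomial time. -/
def Comp (A : Type u) [LinearOrder A] [OrderBot A] {α β : Type*} [Enc A α] [Enc A β]
    (f : α → β) : Prop :=
  ∃ (P : Prog) (p : Polynomial ℕ), ∀ (r : Prog) (x : α), ∃ n,
    Runs r P (enc x : Val A) (enc (f x)) n ∧ n ≤ p.eval (esize A x)

/-! ### Combinators for polynomial-time functions -/

namespace Comp

variable {A : Type u} [LinearOrder A] [OrderBot A]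
variable {α β γ δ : Type*} [Enc A α] [Enc A β] [Enc A γ] [Enc A δ]

theorem congr {f g : α → β} (h : Comp A f) (e : ∀ x, f x = g x) : Comp A g := by
  rwa [← funext e]

/-- A function may be replaced by one that acts in the same way on representations. -/
theorem of_enc {f : α → β} {g : γ → δ} (h : Comp A f) (i : γ → α)
    (hi : ∀ x, (enc (i x) : Val A) = enc x) (ho : ∀ x, (enc (f (i x)) : Val A) = enc (g x)) :
    Comp A g := by
  obtain ⟨P, p, hP⟩ := h
  refine ⟨P, p, fun r x => ?_⟩
  have := hP r (i x)
  rwa [esize, hi, ho] at this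

theorem esize_le {f : α → β} (h : Comp A f) :
    ∃ p : Polynomial ℕ, ∀ x, esize A (f x) ≤ p.eval (esize A x) := by
  obtain ⟨P, p, hP⟩ := h
  refine ⟨p, fun x => ?_⟩
  obtain ⟨n, h1, h2⟩ := hP .call x
  exact h1.size_le.trans h2

theorem comp {g : β → γ} {f : α → β} (hg : Comp A g) (hf : Comp A f) :
    Comp A fun x => g (f x) := by
  obtain ⟨P, p, hP⟩ := hg
  obtain ⟨Q, q, hQ⟩ := hf
  refine ⟨.comp P Q, .X + q + p.comp q + 1, fun r x => ?_⟩
  obtain ⟨m, h1, h2⟩ := hQ r x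
  obtain ⟨n, h3, h4⟩ := hP r (f x)
  refine ⟨_, .comp h1 h3, ?_⟩
  have h5 := p.eval_nat_mono (h1.size_le.trans h2)
  simp only [Polynomial.eval_add, Polynomial.eval_comp, Polynomial.eval_X, Polynomial.eval_one,
    esize] at *
  omega

theorem pair {f : α → β} {g : α → γ} (hf : Comp A f) (hg : Comp A g) :
    Comp A fun x => (f x, g x) := by
  obtain ⟨P, p, hP⟩ := hf
  obtain ⟨Q, q, hQ⟩ := hg
  refine ⟨.pair P Q, .X + p + q + 1, fun r x => ?_⟩
  obtain ⟨m, h1, h2⟩ := hP r x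
  obtain ⟨n, h3, h4⟩ := hQ r x
  refine ⟨_, .pair h1 h3, ?_⟩
  simp only [Polynomial.eval_add, Polynomial.eval_X, Polynomial.eval_one]
  have : esize A x = (enc x : Val A).size := rfl
  omega

theorem of_op (o : Op) {f : α → β} (h : ∀ x, o.apply (enc x : Val A) = enc (f x))
    (hs : ∀ v : Val A, (o.apply v).size ≤ v.size + 3) : Comp A f := by
  refine ⟨.op o, .X + .X + 3, fun r x => ?_⟩
  rw [← h x]
  refine ⟨_, .op r o _, ?_⟩
  have h1 := hs (enc x)
  simp only [Polynomial.eval_add, Polynomial.eval_X, Polynomial.eval_ofNat, esize] at *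
  omega

theorem id : Comp A fun x : α => x :=
  of_op .id (fun _ => rfl) fun v => by simp [Op.apply]

theorem constNil (c : β) (h : (enc c : Val A) = .nil) : Comp A fun _ : α => c :=
  of_op .nil (fun _ => h.symm) fun v => by simp [Op.apply, Val.size]

theorem ofFst {f : α → β} (h : ∀ x, (enc x : Val A).fst = enc (f x)) : Comp A f :=
  of_op .fst h fun v => by cases v <;> simp [Op.apply, Val.fst, Val.size]; omega

theorem ofSnd {f : α → β} (h : ∀ x, (enc x : Val A).snd = enc (f x)) : Comp A f :=
  of_op .snd h fun v => by cases v <;> simp [Op.apply, Val.snd, Val.size]; omega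

omit [LinearOrder A] [OrderBot A] in
theorem ofBool_size_le (b : Bool) : (Val.ofBool b : Val A).size ≤ 3 := by
  cases b <;> simp [Val.ofBool, Val.size]

theorem ofIsPair {f : α → Bool} (h : ∀ x, (enc x : Val A).isPair = f x) : Comp A f :=
  of_op .isPair (fun x => congrArg Val.ofBool (h x))
    fun v => (ofBool_size_le v.isPair).trans (by omega)

theorem ofIsAtom {f : α → Bool} (h : ∀ x, (enc x : Val A).isAtom = f x) : Comp A f :=
  of_op .isAtom (fun x => congrArg Val.ofBool (h x))
    fun v => (ofBool_size_le v.isAtom).trans (by omega)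

theorem ofLe {f : α → Bool} (h : ∀ x, (enc x : Val A).le = f x) : Comp A f :=
  of_op .le (fun x => congrArg Val.ofBool (h x))
    fun v => (ofBool_size_le v.le).trans (by omega)

theorem fst {f : α → β × γ} (h : Comp A f) : Comp A fun x => (f x).1 :=
  comp (g := Prod.fst) (ofFst fun _ => rfl) h

theorem snd {f : α → β × γ} (h : Comp A f) : Comp A fun x => (f x).2 :=
  comp (g := Prod.snd) (ofSnd fun _ => rfl) h

theorem cond {c : α → Bool} {f g : α → β} (hc : Comp A c) (hf : Comp A f) (hg : Comp A g) :
    Comp A fun x => bif c x then f x else g x := by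
  obtain ⟨C, c', hC⟩ := hc
  obtain ⟨P, p, hP⟩ := hf
  obtain ⟨Q, q, hQ⟩ := hg
  refine ⟨.ite C P Q, .X + c' + p + q + 1, fun r x => ?_⟩
  obtain ⟨k, h1, h2⟩ := hC r x
  obtain ⟨m, h3, h4⟩ := hP r x
  obtain ⟨n, h5, h6⟩ := hQ r x
  have : esize A x = (enc x : Val A).size := rfl
  cases hx : c x with
  | true =>
    rw [hx] at h1
    simp only [hx, cond_true]
    refine ⟨_, .ite_true h1 (show Val.pair .nil .nil ≠ .nil from nofun) h3, ?_⟩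
    simp only [Polynomial.eval_add, Polynomial.eval_X, Polynomial.eval_one]
    omega
  | false =>
    rw [hx] at h1
    simp only [hx, cond_false]
    refine ⟨_, .ite_false h1 rfl h5, ?_⟩
    simp only [Polynomial.eval_add, Polynomial.eval_X, Polynomial.eval_one]
    omega

theorem false : Comp A fun _ : α => false := constNil _ rfl

theorem true : Comp A fun _ : α => true :=
  of_enc (pair (α := α) (constNil () rfl) (constNil () rfl)) (fun x => x) (fun _ => rfl)
    fun _ => rfl

theorem not {f : α → Bool} (hf : Comp A f) : Comp A fun x => !f x :=
  (cond hf false true).congr fun x => by cases f x <;> rfl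

theorem and {f g : α → Bool} (hf : Comp A f) (hg : Comp A g) : Comp A fun x => f x && g x :=
  (cond hf hg false).congr fun x => by cases f x <;> rfl

theorem or {f g : α → Bool} (hf : Comp A f) (hg : Comp A g) : Comp A fun x => f x || g x :=
  (cond hf true hg).congr fun x => by cases f x <;> rfl

theorem nil : Comp A fun _ : α => ([] : List β) := constNil _ rfl

theorem cons {f : α → β} {g : α → List β} (hf : Comp A f) (hg : Comp A g) :
    Comp A fun x => f x :: g x :=
  of_enc (pair hf hg) (fun x => x) (fun _ => rfl) fun _ => rfl

theorem tail {f : α → List β} (hf : Comp A f) : Comp A fun x => (f x).tail :=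
  comp (g := List.tail) (ofSnd fun l => by cases l <;> rfl) hf

theorem isEmpty {f : α → List β} (hf : Comp A f) : Comp A fun x => (f x).isEmpty :=
  (not (f := fun x => !(f x).isEmpty)
    (comp (g := fun l : List β => !l.isEmpty) (ofIsPair fun l => by cases l <;> rfl) hf)).congr
    fun x => by simp

theorem headD {f : α → List β} (hf : Comp A f) (d : β) (hd : (enc d : Val A) = .nil) :
    Comp A fun x => (f x).headD d :=
  comp (g := fun l : List β => l.headD d)
    (ofFst fun l => by cases l; exacts [hd.symm, rfl]) hf

/-- Recursion over forests, that is, over lists whose elements have lists of children. -/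
theorem forest {sub : α → List α} {k₁ k₂ : α × List α × γ → γ} {g : γ → β}
    {h : (α × List α × γ) × β × β → β} {f : List α × γ → β}
    (hsub : Comp A sub) (hk₁ : Comp A k₁) (hk₂ : Comp A k₂) (hg : Comp A g) (hh : Comp A h)
    (sub_le : ∀ x, esize A (sub x) ≤ esize A x)
    (k₁_le : ∀ x l e, esize A (sub x) + esize A (k₁ (x, l, e)) ≤ esize A (x :: l) + esize A e)
    (k₂_le : ∀ x l e, esize A l + esize A (k₂ (x, l, e)) ≤ esize A (x :: l) + esize A e)
    (f_nil : ∀ e, f ([], e) = g e)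
    (f_cons : ∀ x l e,
      f (x :: l, e) = h ((x, l, e), f (sub x, k₁ (x, l, e)), f (l, k₂ (x, l, e))))
    (f_le : ∃ p : Polynomial ℕ, ∀ s, esize A (f s) ≤ p.eval (esize A s)) : Comp A f := by
  obtain ⟨D, pD, hD⟩ : Comp A fun s : (Val A × Val A) × Val A => (s.1.1, (s.1.2, s.2)) :=
    pair (fst (fst id)) (pair (snd (fst id)) (snd id))
  obtain ⟨C, pC, hC⟩ : Comp A fun s : List α × γ => !s.1.isEmpty := not (isEmpty (fst id))
  obtain ⟨G, pG, hG⟩ : Comp A fun s : List α × γ => g s.2 := comp hg (snd id)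
  obtain ⟨Q, pQ, hQ⟩ : Comp A fun i : α × List α × γ => (sub i.1, k₁ i) :=
    pair (comp hsub (fst id)) hk₁
  obtain ⟨R, pR, hR⟩ : Comp A fun i : α × List α × γ => (i.2.1, k₂ i) :=
    pair (fst (snd id)) hk₂
  obtain ⟨H, pH, hH⟩ := hh
  obtain ⟨pf, hf⟩ := f_le
  -- `Comp` promises runs under every enclosing recursive function, so the component programs may be
  -- used inside `body`, where `.call` refers to `body` itself. `D` regroups the datum of `(x :: l,
  -- e)` into that of `(x, l, e)`.
  let body : Prog :=
    .ite C (.comp H (.comp (.pair (.op .id) (.pair (.comp .call Q) (.comp .call R))) D)) G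
  -- `K.eval B` pays for one call without its recursive calls when list and parameter have total
  -- size at most `B`. The pair of both then has size at most `B + 1`, and each recursive result at
  -- most `pf.eval (B + 1)`. The numerical coefficients are generous.
  obtain ⟨K, hK⟩ : ∃ K : Polynomial ℕ, ∀ B, K.eval B = (B + 1) + pC.eval (B + 1) + pG.eval (B + 1) +
      pD.eval (B + 1) + pQ.eval (B + 1) + pR.eval (B + 1) +
      pH.eval (B + 1 + 2 * pf.eval (B + 1) + 2) + 4 * (pQ.eval (B + 1) + pR.eval (B + 1)) +
      20 * (B + 1) + 20 + pf.eval (B + 1) :=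
    ⟨(.X + 1) + pC.comp (.X + 1) + pG.comp (.X + 1) + pD.comp (.X + 1) + pQ.comp (.X + 1) +
      pR.comp (.X + 1) + pH.comp (.X + 1 + 2 * pf.comp (.X + 1) + 2) +
      4 * (pQ.comp (.X + 1) + pR.comp (.X + 1)) + 20 * (.X + 1) + 20 + pf.comp (.X + 1),
      fun B => by simp⟩
  -- By `k₁_le` and `k₂_le` the total size of list and parameter never grows, so a single `B` serves
  -- the whole recursion. The two recursive budgets and one more `K.eval B` fit into the budget of
  -- `x :: l`, because its size is at least that of `sub x` plus that of `l` plus one.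
  have key : ∀ B m l e, esize A l ≤ m → esize A l + esize A e ≤ B →
      ∃ n, Runs body body (enc (l, e) : Val A) (enc (f (l, e))) n ∧
        n ≤ (2 * esize A l + 1) * K.eval B := by
    intro B m
    induction m with
    | zero => intro l e h1; have := esize_pos (A := A) l; omega
    | succ m ih =>
      intro l e hm hB
      have hv : esize A (l, e) ≤ B + 1 := by rw [esize_mk]; omega
      obtain ⟨nc, c1, c2⟩ := hC body (l, e)
      have c3 := pC.eval_nat_mono hv
      simp only at c3
      cases l with
      | nil =>
        obtain ⟨ng, g1, g2⟩ := hG body ([], e)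
        have g3 := pG.eval_nat_mono hv
        simp only at g3
        rw [f_nil]
        refine ⟨_, .ite_false c1 rfl g1, ?_⟩
        have : (enc (([] : List α), e) : Val A).size ≤ B + 1 := hv
        have hK' := hK B
        calc _ ≤ 1 * K.eval B := by omega
          _ ≤ _ := Nat.mul_le_mul_right _ (by omega)
      | cons x l =>
        have ex := esize_pos (A := A) x
        have es := sub_le x
        have e1 := k₁_le x l e
        have e2 := k₂_le x l e
        have el := esize_cons (A := A) x l
        obtain ⟨n1, r1, r2⟩ := ih (sub x) (k₁ (x, l, e)) (by omega) (by omega)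
        obtain ⟨n2, r3, r4⟩ := ih l (k₂ (x, l, e)) (by omega) (by omega)
        obtain ⟨nd, d1, d2⟩ := hD body ((enc x, enc l), enc e)
        have d3 := pD.eval_nat_mono hv
        obtain ⟨nq, q1, q2⟩ := hQ body (x, l, e)
        obtain ⟨nr, s1, s2⟩ := hR body (x, l, e)
        have hi : esize A (x, l, e) ≤ B + 1 := by
          rw [esize_mk] at hv ⊢; rw [esize_mk]; omega
        have q3 := pQ.eval_nat_mono hi
        have s3 := pR.eval_nat_mono hi
        set o1 := f (sub x, k₁ (x, l, e)) with ho1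
        set o2 := f (l, k₂ (x, l, e)) with ho2
        obtain ⟨nh, t1, t2⟩ := hH body ((x, l, e), o1, o2)
        have b1 : esize A o1 ≤ pf.eval (B + 1) :=
          (hf _).trans (pf.eval_nat_mono (by rw [esize_mk]; omega))
        have b2 : esize A o2 ≤ pf.eval (B + 1) :=
          (hf _).trans (pf.eval_nat_mono (by rw [esize_mk]; omega))
        have ht : esize A ((x, l, e), o1, o2) ≤ B + 1 + 2 * pf.eval (B + 1) + 2 := by
          rw [esize_mk, esize_mk (α := β)]; omega
        have t3 := pH.eval_nat_mono ht
        rw [f_cons, ← ho1, ← ho2]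
        have run := Runs.ite_true (g := G) c1 (show Val.pair .nil .nil ≠ .nil from nofun)
          (Runs.comp (Runs.comp d1 (Runs.pair (Runs.op body .id _)
            (Runs.pair (Runs.comp q1 (.call r1)) (Runs.comp s1 (.call r3))))) t1)
        refine ⟨_, run, ?_⟩
        have z1 : (enc (x :: l, e) : Val A).size ≤ B + 1 := hv
        have z2 : (enc ((enc x : Val A), (enc l : Val A), (enc e : Val A)) : Val A).size ≤ B + 1 :=
          hi
        have z3 := q1.size_le
        have z4 := s1.size_le
        have z5 : (Val.pair (Val.pair (enc x : Val A) (enc l)) (enc e)).size ≤ B + 1 := hv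
        have hK' := hK B
        have z7 : esize A (((enc x : Val A), (enc l : Val A)), (enc e : Val A)) ≤ B + 1 := hv
        have d4 := pD.eval_nat_mono z7
        simp only at d3 d4 q3 s3 t3
        refine Nat.le_trans (m := n1 + n2 + K.eval B) ?_ ?_
        · simp only [Op.apply, enc_mk, esize] at *
          simp only [Val.size] at *
          omega
        · calc _ ≤ (2 * esize A (sub x) + 1) * K.eval B + (2 * esize A l + 1) * K.eval B +
                1 * K.eval B := by omega
            _ = (2 * (esize A (sub x) + esize A l + 1) + 1) * K.eval B := by ring
            _ ≤ _ := Nat.mul_le_mul_right _ (by omega)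
  have base : ∀ s, ∃ n, Runs body body (enc s : Val A) (enc (f s)) n ∧
      n ≤ (2 * esize A s + 1) * K.eval (esize A s) := by
    rintro ⟨l, e⟩
    have := esize_mk (A := A) l e
    obtain ⟨n, h1, h2⟩ := key (esize A (l, e)) _ l e le_rfl (by omega)
    exact ⟨n, h1, h2.trans (Nat.mul_le_mul_right _ (by omega))⟩
  refine ⟨.fix body, .X + (2 * .X + 1) * K + 1, fun r s => ?_⟩
  obtain ⟨n, h1, h2⟩ := base s
  refine ⟨_, .fix h1, ?_⟩
  simp only [Polynomial.eval_add, Polynomial.eval_mul, Polynomial.eval_X, Polynomial.eval_one,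
    Polynomial.eval_ofNat]
  simp only [esize] at *
  omega

end Comp

namespace Comp

variable {A : Type u} [LinearOrder A] [OrderBot A]
variable {α β γ δ σ : Type*} [Enc A α] [Enc A β] [Enc A γ] [Enc A δ] [Enc A σ]

/-! ### Lists -/

/-- Recursion over forests without children: the first recursive call is made on the empty list and
its result is ignored. -/
theorem list {k : α × List α × γ → γ} {g : γ → β} {h : (α × List α × γ) × β → β}
    {f : List α × γ → β} (hk : Comp A k) (hg : Comp A g) (hh : Comp A h)
    (k_le : ∀ x l e, esize A l + esize A (k (x, l, e)) ≤ esize A (x :: l) + esize A e)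
    (f_nil : ∀ e, f ([], e) = g e)
    (f_cons : ∀ x l e, f (x :: l, e) = h ((x, l, e), f (l, k (x, l, e))))
    (f_le : ∃ p : Polynomial ℕ, ∀ s, esize A (f s) ≤ p.eval (esize A s)) : Comp A f := by
  refine forest (sub := fun _ => []) (k₁ := fun i => i.2.2) (h := fun i => h (i.1, i.2.2)) nil
    (snd (snd id)) hk hg (comp hh (pair (fst id) (snd (snd id)))) (fun x => ?_) (fun x l e => ?_)
    k_le f_nil f_cons f_le
  · exact esize_pos x
  · have := esize_pos (A := A) x
    simp only [esize_nil, esize_cons]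
    omega

theorem append {f g : σ → List α} (hf : Comp A f) (hg : Comp A g) :
    Comp A fun x => f x ++ g x := by
  refine comp (g := fun s : List α × List α => s.1 ++ s.2) (list (k := fun i => i.2.2)
    (g := fun e => e) (h := fun i => i.1.1 :: i.2) (snd (snd id)) id
    (cons (fst (fst id)) (snd id)) (fun x l e => ?_) (fun _ => rfl) (fun _ _ _ => rfl)
    ⟨.X, fun s => ?_⟩) (pair hf hg)
  · simp only [esize_cons]; omega
  · have := esize_append (A := A) s.1 s.2
    have := esize_mk (A := A) s.1 s.2
    simp only [Polynomial.eval_X, Prod.mk.eta] at *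
    omega

theorem flatMap {l : σ → List α} {φ : σ → α → List β} (hl : Comp A l)
    (hφ : Comp A fun s : σ × α => φ s.1 s.2) : Comp A fun x => (l x).flatMap (φ x) := by
  refine comp (g := fun s : List α × σ => s.1.flatMap (φ s.2)) (list (k := fun i => i.2.2)
    (g := fun _ : σ => []) (h := fun i => φ i.1.2.2 i.1.1 ++ i.2) (snd (snd id)) nil
    (append (comp hφ (pair (snd (snd (fst id))) (fst (fst id)))) (snd id)) (fun x l e => ?_)
    (fun _ => rfl) (fun _ _ _ => rfl) ?_) (pair hl id)
  · simp only [esize_cons]; omega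
  · obtain ⟨p, hp⟩ := hφ.esize_le
    refine ⟨.X * (p + 1), ?_⟩
    -- Each element contributes at most `p.eval B` to the result, and the number of elements is
    -- bounded by the size of the list.
    have key : ∀ B (e : σ) (l : List α), esize A l + esize A e ≤ B →
        esize A (l.flatMap (φ e)) ≤ esize A l * (p.eval B + 1) := by
      intro B e l
      induction l with
      | nil => intro _; simp [esize_nil]
      | cons x l ih =>
        intro hB
        rw [esize_cons] at hB ⊢
        have h1 := ih (by omega)
        have h2 := esize_append (A := A) (φ e x) (l.flatMap (φ e))
        have h3 := esize_pos (A := A) l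
        have h4 : esize A (φ e x) ≤ p.eval B :=
          (hp (e, x)).trans (p.eval_nat_mono (by rw [esize_mk]; omega))
        rw [List.flatMap_cons]
        calc _ ≤ esize A l * (p.eval B + 1) + (p.eval B + 1) := by omega
          _ ≤ (esize A x + esize A l + 1) * (p.eval B + 1) := by rw [Nat.add_mul, Nat.add_mul]; omega
    rintro ⟨l, e⟩
    have h1 := esize_mk (A := A) l e
    refine (key (esize A (l, e)) e l (by omega)).trans ?_
    simp only [Polynomial.eval_mul, Polynomial.eval_X, Polynomial.eval_add, Polynomial.eval_one]
    exact Nat.mul_le_mul_right _ (by omega)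

theorem map {l : σ → List α} {φ : σ → α → β} (hl : Comp A l)
    (hφ : Comp A fun s : σ × α => φ s.1 s.2) : Comp A fun x => (l x).map (φ x) :=
  (flatMap (φ := fun x a => [φ x a]) hl (cons hφ nil)).congr fun x => by
    rw [← List.map_eq_flatMap]

theorem filter {l : σ → List α} {φ : σ → α → Bool} (hl : Comp A l)
    (hφ : Comp A fun s : σ × α => φ s.1 s.2) : Comp A fun x => (l x).filter (φ x) :=
  (flatMap (φ := fun x a => bif φ x a then [a] else []) hl
    (cond hφ (cons (snd id) nil) nil)).congr fun x => by
    induction l x with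
    | nil => rfl
    | cons a l ih => rw [List.flatMap_cons, ih]; cases h : φ x a <;> simp [h]

theorem any {l : σ → List α} {φ : σ → α → Bool} (hl : Comp A l)
    (hφ : Comp A fun s : σ × α => φ s.1 s.2) : Comp A fun x => (l x).any (φ x) :=
  (not (isEmpty (filter hl hφ))).congr fun x => by
    induction l x with
    | nil => rfl
    | cons a l ih => rw [List.any_cons, ← ih]; cases h : φ x a <;> simp [h]

theorem all {l : σ → List α} {φ : σ → α → Bool} (hl : Comp A l)
    (hφ : Comp A fun s : σ × α => φ s.1 s.2) : Comp A fun x => (l x).all (φ x) :=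
  (not (any (φ := fun x a => !φ x a) hl (not hφ))).congr fun x => by
    induction l x with
    | nil => rfl
    | cons a l ih => rw [List.all_cons, ← ih]; simp

omit [LinearOrder A] [OrderBot A] in
theorem bool_le {f : α → Bool} : ∃ p : Polynomial ℕ, ∀ s, esize A (f s) ≤ p.eval (esize A s) :=
  ⟨3, fun s => by rw [Polynomial.eval_ofNat]; exact ofBool_size_le (f s)⟩

/-- The recursion runs along the first list while the second one travels as the parameter and loses
its head in each call. The default `d` must be encoded as `nil` because that is the first component
of the empty list's datum. -/
theorem isPrefixOf [BEq α] (d : α) (hd : (enc d : Val A) = .nil)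
    (heq : Comp A fun s : α × α => s.1 == s.2) {f g : σ → List α} (hf : Comp A f)
    (hg : Comp A g) : Comp A fun x => (f x).isPrefixOf (g x) := by
  refine comp (g := fun s : List α × List α => s.1.isPrefixOf s.2) (list (k := fun i => i.2.2.tail)
    (g := fun _ : List α => Bool.true)
    (h := fun i : (α × List α × List α) × Bool => !i.1.2.2.isEmpty && (i.1.1 == i.1.2.2.headD d && i.2)) (tail (snd (snd id))) true
    (and (not (isEmpty (snd (snd (fst id))))) (and (comp heq
      (pair (fst (fst id)) (headD (snd (snd (fst id))) d hd))) (snd id))) (fun x l e => ?_)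
      (fun _ => rfl) (fun x l e => ?_) bool_le) (pair hf hg)
  · cases e <;> simp only [List.tail_nil, List.tail_cons, esize_cons, esize_nil] <;> omega
  · cases e <;> simp [List.isPrefixOf]

theorem dropLast {f : σ → List α} (hf : Comp A f) : Comp A fun x => (f x).dropLast := by
  refine comp (g := fun s : List α × Unit => s.1.dropLast) (list (k := fun i => i.2.2)
    (g := fun _ : Unit => []) (h := fun i => bif i.1.2.1.isEmpty then [] else i.1.1 :: i.2)
    (snd (snd id)) nil (cond (isEmpty (fst (snd (fst id)))) nil (cons (fst (fst id)) (snd id)))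
    (fun x l e => ?_) (fun _ => rfl) (fun x l e => ?_) ⟨.X, fun s => ?_⟩)
    (pair hf (constNil () rfl))
  · simp only [esize_cons]; omega
  · cases l <;> rfl
  · rw [Polynomial.eval_X, esize_mk]
    induction s.1 with
    | nil => simp only [List.dropLast_nil]; omega
    | cons x l ih =>
      cases l with
      | nil => simp only [List.dropLast_singleton, esize_nil, esize_cons]; omega
      | cons y l => rw [List.dropLast_cons_cons, esize_cons, esize_cons (x := x)]; omega

/-! ### Numbers and addresses -/

/-- A number in unary has the same datum as a list of that many units, so comparison of numbers is a
prefix test. -/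
theorem natLe {f g : σ → ℕ} (hf : Comp A f) (hg : Comp A g) :
    Comp A fun x => decide (f x ≤ g x) := by
  have h : Comp A fun s : List Unit × List Unit => s.1.isPrefixOf s.2 :=
    isPrefixOf () rfl (true.congr fun _ => rfl) (fst id) (snd id)
  have e : ∀ n : ℕ, (enc (List.replicate n ()) : Val A) = enc n := by
    intro n
    induction n with
    | zero => rfl
    | succ n ih => rw [List.replicate_succ, enc_cons, ih]; rfl
  refine comp (g := fun s : ℕ × ℕ => decide (s.1 ≤ s.2)) (of_enc h
    (fun s => (List.replicate s.1 (), List.replicate s.2 ()))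
    (fun s => by rw [enc_mk, e, e]; rfl) fun s => congrArg _ ?_) (pair hf hg)
  rw [Bool.eq_iff_iff, List.isPrefixOf_iff_prefix, decide_eq_true_iff]
  constructor
  · intro h; simpa using h.length_le
  · intro h
    obtain ⟨k, hk⟩ := Nat.exists_eq_add_of_le h
    rw [hk, List.replicate_add]
    exact List.prefix_append _ _

theorem natEq {f g : σ → ℕ} (hf : Comp A f) (hg : Comp A g) : Comp A fun x => f x == g x :=
  (and (natLe hf hg) (natLe hg hf)).congr fun x => by
    rw [Bool.eq_iff_iff]; simp; omega

theorem succ {f : σ → ℕ} (hf : Comp A f) : Comp A fun x => f x + 1 :=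
  of_enc (pair (constNil () rfl) hf) (fun x => x) (fun _ => rfl) fun _ => rfl

theorem addressPrefix {f g : σ → List ℕ} (hf : Comp A f) (hg : Comp A g) :
    Comp A fun x => (f x).isPrefixOf (g x) :=
  isPrefixOf 0 rfl (natEq (fst id) (snd id)) hf hg

theorem addressEq {f g : σ → List ℕ} (hf : Comp A f) (hg : Comp A g) :
    Comp A fun x => f x == g x :=
  (and (addressPrefix hf hg) (addressPrefix hg hf)).congr fun x => by
    rw [Bool.eq_iff_iff]
    simp only [Bool.and_eq_true, List.isPrefixOf_iff_prefix, beq_iff_eq]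
    exact ⟨fun h => h.1.eq_of_length_le h.2.length_le, fun h => h ▸ ⟨List.prefix_rfl, List.prefix_rfl⟩⟩

end Comp

/-! ### Labels -/

/-- Both labels are present and equal. -/
def sameLab {A : Type u} [LinearOrder A] : Option A → Option A → Bool
  | some a, some b => decide (a ≤ b) && decide (b ≤ a)
  | _, _ => false

theorem sameLab_iff {A : Type u} [LinearOrder A] {a b : Option A} :
    sameLab a b = true ↔ ∃ c, a = some c ∧ b = some c := by
  cases a <;> cases b <;> simp [sameLab]
  exact ⟨fun h => le_antisymm h.2 h.1, fun h => h ▸ ⟨le_rfl, le_rfl⟩⟩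

/-- The query label `a` is a wildcard or equal to `b`. -/
def labMatches {A : Type u} [LinearOrder A] (a b : Option A) : Bool :=
  a.isNone || sameLab a b

theorem labMatches_iff {A : Type u} [LinearOrder A] {a b : Option A} :
    labMatches a b = true ↔ ∀ c, a = some c → b = some c := by
  cases a <;> simp [labMatches, sameLab_iff]

def Axis.isDesc : Axis → Bool
  | child => false
  | desc => true

namespace Comp

variable {A : Type u} [LinearOrder A] [OrderBot A] {σ : Type*} [Enc A σ]

theorem same {f g : σ → Option A} (hf : Comp A f) (hg : Comp A g) :
    Comp A fun x => sameLab (f x) (g x) := by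
  have h : Comp A fun s : Option A × Option A => Val.le (.pair (encodeLabel s.1) (encodeLabel s.2)) :=
    ofLe fun _ => rfl
  refine (and (comp h (pair hf hg)) (comp h (pair hg hf))).congr fun x => ?_
  cases f x <;> cases g x <;> rfl

theorem isNone {f : σ → Option A} (hf : Comp A f) : Comp A fun x => (f x).isNone :=
  (not (comp (g := fun l : Option A => l.isSome) (ofIsAtom fun l => by cases l <;> rfl) hf)).congr
    fun x => by cases f x <;> rfl

theorem labels {f g : σ → Option A} (hf : Comp A f) (hg : Comp A g) :
    Comp A fun x => labMatches (f x) (g x) :=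
  or (isNone hf) (same hf hg)

theorem noLabel : Comp A fun _ : σ => (none : Option A) := constNil _ rfl

theorem isDesc {f : σ → Axis} (hf : Comp A f) : Comp A fun x => (f x).isDesc :=
  of_enc (f := fun x => f x) hf (fun x => x) (fun _ => rfl) fun x => by cases f x <;> rfl

theorem child : Comp A fun _ : σ => Axis.child := constNil _ rfl

theorem desc : Comp A fun _ : σ => Axis.desc :=
  of_enc (f := fun _ : σ => Bool.true) true (fun x => x) (fun _ => rfl) fun _ => rfl

/-! ### Trees and queries -/

theorem treeLabel {f : σ → LTree A} (hf : Comp A f) : Comp A fun x => some (f x).label :=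
  comp (g := fun t : LTree A => some t.label)
    (ofFst fun t => by cases t; simp only [enc, LTree.encode, Val.fst, encodeLabel, LTree.label]) hf

end Comp

def LTree.children {A : Type u} : LTree A → List (LTree A)
  | node _ ts => ts

theorem LTree.enc_node {A : Type u} (a : A) (ts : List (LTree A)) :
    (enc (node a ts) : Val A) = .pair (enc (some a)) (enc ts) := by
  simp only [enc, LTree.encode]; rfl

theorem Twig.enc_node {A : Type u} (a : Option A) (cs : List (Axis × Twig A)) :
    (enc (node a cs) : Val A) = .pair (enc a) (enc cs) := by
  simp only [enc, Twig.encode]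

namespace Comp

variable {A : Type u} [LinearOrder A] [OrderBot A] {σ : Type*} [Enc A σ]

theorem treeChildren {f : σ → LTree A} (hf : Comp A f) : Comp A fun x => (f x).children :=
  comp (g := LTree.children) (ofSnd fun t => by cases t; rw [LTree.enc_node]; rfl) hf

theorem twigLabel {f : σ → Twig A} (hf : Comp A f) : Comp A fun x => (f x).label :=
  comp (g := Twig.label) (ofFst fun t => by cases t; rw [Twig.enc_node]; rfl) hf

theorem twigChildren {f : σ → Twig A} (hf : Comp A f) : Comp A fun x => (f x).children :=
  comp (g := Twig.children) (ofSnd fun t => by cases t; rw [Twig.enc_node]; rfl) hf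

theorem twigNode {f : σ → Option A} {g : σ → List (Axis × Twig A)} (hf : Comp A f)
    (hg : Comp A g) : Comp A fun x => Twig.node (f x) (g x) :=
  of_enc (pair hf hg) (fun x => x) (fun _ => rfl) fun _ => (Twig.enc_node _ _).symm

end Comp

/-! ## Reading queries off trees and listing the nodes of queries -/

section

variable {A : Type u}

/-- A node of a query with its address, the kind of the edge that leads to it and its label. -/
abbrev NodeRec (A : Type u) : Type u := List ℕ × Axis × Option A

namespace Twig

/-- The nodes of a forest; `p` is the address of the parent and `i` the number of siblings that
precede the forest. -/
def forestNodes : List (Axis × Twig A) → List ℕ → ℕ → List (NodeRec A)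
  | [], _, _ => []
  | (k, node l cs) :: rest, p, i =>
    (p ++ [i], k, l) :: (forestNodes cs (p ++ [i]) 0 ++ forestNodes rest p (i + 1))

/-- The nodes of a query. The root is listed as if it were reached by a child edge. -/
def nodes (q : Twig A) : List (NodeRec A) :=
  ([], .child, q.label) :: forestNodes q.children [] 0

end Twig

namespace LTree

variable [LinearOrder A]

/-- Read trees as queries: the label `z` stands for the wildcard, and nodes with the label `y`
are contracted to descendant edges. -/
def forestRead : List (LTree A) → Option A → Option A → Axis → List (Axis × Twig A)
  | [], _, _, _ => []
  | node a us :: rest, y, z, k =>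
    bif sameLab (some a) y then forestRead us y z .desc ++ forestRead rest y z k
    else (k, .node (bif sameLab (some a) z then none else some a) (forestRead us y z .child)) ::
      forestRead rest y z k

def read (t : LTree A) (y z : Option A) : Twig A :=
  .node (bif sameLab (some t.label) z then none else some t.label)
    (forestRead t.children y z .child)

end LTree

theorem Axis.esize_le (k : Axis) : esize A k ≤ 3 := by
  cases k <;> simp [esize, enc, Axis.encode, Val.ofBool, Val.size]

theorem esize_label (l : Option A) : esize A l = 1 := by
  cases l <;> rfl

theorem Twig.esize_node (l : Option A) (cs : List (Axis × Twig A)) :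
    esize A (node l cs) = esize A cs + 2 := by
  rw [esize, Twig.enc_node, Val.size, ← esize, ← esize, esize_label]; omega

theorem LTree.esize_node (a : A) (ts : List (LTree A)) :
    esize A (node a ts) = esize A ts + 2 := by
  rw [esize, LTree.enc_node, Val.size, ← esize, ← esize, esize_label]; omega

/-- Induction over the nested type. A statement about a single query is obtained from the forest
that consists of it alone. -/
theorem Twig.forest_induction {P : List (Axis × Twig A) → Prop} (nil : P [])
    (cons : ∀ k l cs rest, P cs → P rest → P ((k, node l cs) :: rest)) : ∀ L, P L
  | [] => nil
  | (k, node l cs) :: rest =>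
    cons k l cs rest (forest_induction nil cons cs) (forest_induction nil cons rest)

theorem LTree.forest_induction {P : List (LTree A) → Prop} (nil : P [])
    (cons : ∀ a us rest, P us → P rest → P (node a us :: rest)) : ∀ L, P L
  | [] => nil
  | node a us :: rest =>
    cons a us rest (forest_induction nil cons us) (forest_induction nil cons rest)

/-- Addresses get longer during the recursion, but never by more than the remaining forest shrinks.
The invariant bound `B` therefore limits every single record, up to a constant. -/
theorem Twig.esize_forestNodes (B : ℕ) (L : List (Axis × Twig A)) (p : List ℕ) (i : ℕ) :
    esize A L + esize A p + esize A i ≤ B →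
      esize A (forestNodes L p i) ≤ esize A L * (B + 7) := by
  induction L using forest_induction generalizing p i with
  | nil => intro _; simp [forestNodes, esize_nil]
  | cons k l cs rest ih1 ih2 =>
    intro hB
    rw [forestNodes, esize_cons, esize_cons]
    rw [esize_cons] at hB
    simp only [esize_mk, Twig.esize_node] at hB ⊢
    have h1 := esize_append (A := A) p [i]
    rw [esize_cons, esize_nil] at h1
    have h2 := esize_append (A := A) (forestNodes cs (p ++ [i]) 0) (forestNodes rest p (i + 1))
    have h3 : esize A (i + 1) = esize A i + 2 := by simp [esize, enc, Val.ofNat, Val.size]; omega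
    have h4 : esize A 0 = 1 := rfl
    have h5 := esize_pos (A := A) k
    have h6 := esize_pos (A := A) rest
    have h7 := esize_pos (A := A) cs
    have h8 := ih1 (p ++ [i]) 0 (by omega)
    have h9 := ih2 p (i + 1) (by omega)
    have h10 := k.esize_le (A := A)
    have h11 := esize_label l
    calc _ ≤ 1 * (B + 7) + esize A cs * (B + 7) + esize A rest * (B + 7) := by omega
      _ = (1 + esize A cs + esize A rest) * (B + 7) := by ring
      _ ≤ _ := Nat.mul_le_mul_right _ (by omega)

theorem LTree.esize_forestRead [LinearOrder A] (L : List (LTree A)) (y z : Option A) (k : Axis) :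
    esize A (forestRead L y z k) ≤ 8 * esize A L := by
  induction L using forest_induction generalizing y z k with
  | nil => simp [forestRead, esize_nil]
  | cons a us rest ih1 ih2 =>
    rw [forestRead, esize_cons, LTree.esize_node]
    cases sameLab (some a) y with
    | true =>
      have := esize_append (A := A) (forestRead us y z .desc) (forestRead rest y z k)
      have := ih1 y z .desc
      have := ih2 y z k
      simp only [cond_true]
      omega
    | false =>
      have := ih1 y z .child
      have := ih2 y z k
      have := k.esize_le (A := A)
      simp only [cond_false, esize_cons, esize_mk, Twig.esize_node]
      omega

end

/-! ### Polynomial time of listing nodes and of reading trees as queries -/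

namespace Comp

variable {A : Type u} [LinearOrder A] [OrderBot A] {σ : Type*} [Enc A σ]

theorem nodes {f : σ → Twig A} (hf : Comp A f) : Comp A fun x => (f x).nodes := by
  have h : Comp A fun s : List (Axis × Twig A) × List ℕ × ℕ =>
      Twig.forestNodes s.1 s.2.1 s.2.2 := by
    refine forest (sub := fun x => x.2.children) (k₁ := fun i => (i.2.2.1 ++ [i.2.2.2], 0))
      (k₂ := fun i => (i.2.2.1, i.2.2.2 + 1)) (g := fun _ : List ℕ × ℕ => [])
      (h := fun i : ((Axis × Twig A) × _ × _ × _) × List (NodeRec A) × List (NodeRec A) =>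
        (i.1.2.2.1 ++ [i.1.2.2.2], i.1.1.1, i.1.1.2.label) :: (i.2.1 ++ i.2.2))
      (twigChildren (snd id))
      (pair (append (fst (snd (snd id))) (cons (snd (snd (snd id))) nil)) (constNil 0 rfl))
      (pair (fst (snd (snd id))) (succ (snd (snd (snd id))))) nil
      (cons (pair (append (fst (snd (snd (fst id)))) (cons (snd (snd (snd (fst id)))) nil))
        (pair (fst (fst (fst id))) (twigLabel (snd (fst (fst id)))))) (append (fst (snd id))
          (snd (snd id))))
      ?_ ?_ ?_ ?_ ?_ ?_
    · rintro ⟨k, l, cs⟩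
      rw [esize_mk, Twig.esize_node]
      simp only [Twig.children]
      omega
    · rintro ⟨k, l, cs⟩ rest ⟨p, i⟩
      have h1 := esize_append (A := A) p [i]
      have h2 := esize_pos (A := A) k
      have h4 : esize A 0 = 1 := rfl
      rw [esize_cons, esize_nil] at h1
      simp only [esize_cons, esize_mk, Twig.esize_node, Twig.children]
      omega
    · rintro ⟨k, l, cs⟩ rest ⟨p, i⟩
      have h3 : esize A (i + 1) = esize A i + 2 := by simp [esize, enc, Val.ofNat, Val.size]; omega
      simp only [esize_cons, esize_mk, Twig.esize_node]
      omega
    · intro e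
      rw [Twig.forestNodes]
    · rintro ⟨k, l, cs⟩ rest ⟨p, i⟩
      rw [Twig.forestNodes]
      rfl
    · refine ⟨.X * (.X + 7), fun s => ?_⟩
      have h1 := esize_mk (A := A) s.1 s.2
      have h2 := esize_mk (A := A) s.2.1 s.2.2
      refine (Twig.esize_forestNodes (esize A s) s.1 s.2.1 s.2.2 ?_).trans ?_
      · simp only [Prod.mk.eta] at *; omega
      · simp only [Polynomial.eval_mul, Polynomial.eval_X, Polynomial.eval_add,
          Polynomial.eval_ofNat]
        exact Nat.mul_le_mul_right _ (by simp only [Prod.mk.eta] at *; omega)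
  exact cons (pair nil (pair child (twigLabel hf)))
    (comp h (pair (twigChildren hf) (pair nil (constNil 0 rfl))))

theorem read {f : σ → LTree A} {y z : σ → Option A} (hf : Comp A f) (hy : Comp A y)
    (hz : Comp A z) : Comp A fun x => (f x).read (y x) (z x) := by
  have h : Comp A fun s : List (LTree A) × Option A × Option A × Axis =>
      LTree.forestRead s.1 s.2.1 s.2.2.1 s.2.2.2 := by
    refine forest (sub := LTree.children) (k₁ := fun i => (i.2.2.1, i.2.2.2.1,
        bif sameLab (some i.1.label) i.2.2.1 then .desc else .child))
      (k₂ := fun i => i.2.2) (g := fun _ : Option A × Option A × Axis => [])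
      (h := fun i : (LTree A × _ × _ × _) × List (Axis × Twig A) × List (Axis × Twig A) =>
        bif sameLab (some i.1.1.label) i.1.2.2.1 then i.2.1 ++ i.2.2 else
        (i.1.2.2.2.2, .node (bif sameLab (some i.1.1.label) i.1.2.2.2.1 then none
          else some i.1.1.label) i.2.1) :: i.2.2)
      (treeChildren id)
      (pair (fst (snd (snd id))) (pair (fst (snd (snd (snd id))))
        (cond (same (treeLabel (fst id)) (fst (snd (snd id)))) desc child)))
      (snd (snd id)) nil
      (cond (same (treeLabel (fst (fst id))) (fst (snd (snd (fst id)))))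
        (append (fst (snd id)) (snd (snd id)))
        (cons (pair (snd (snd (snd (snd (fst id))))) (twigNode
          (cond (same (treeLabel (fst (fst id))) (fst (snd (snd (snd (fst id)))))) noLabel
            (treeLabel (fst (fst id)))) (fst (snd id)))) (snd (snd id))))
      ?_ ?_ ?_ ?_ ?_ ⟨8 * .X, fun s => ?_⟩
    · rintro ⟨a, us⟩
      rw [LTree.esize_node]
      simp only [LTree.children]
      omega
    -- The edge kind in the parameter may grow from size 1 to size 3; the node that has been
    -- consumed pays for it.
    · rintro ⟨a, us⟩ rest ⟨y, z, k⟩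
      have h1 := esize_pos (A := A) k
      have h2 := (bif sameLab (some a) y then Axis.desc else Axis.child).esize_le (A := A)
      have h3 := esize_pos (A := A) rest
      simp only [esize_cons, esize_mk, LTree.esize_node, LTree.children, LTree.label] at *
      omega
    · rintro ⟨a, us⟩ rest e
      simp only [esize_cons]
      omega
    · intro e
      rw [LTree.forestRead]
    · rintro ⟨a, us⟩ rest ⟨y, z, k⟩
      simp only [LTree.forestRead, LTree.children, LTree.label]
      cases sameLab (some a) y <;> rfl
    · refine (LTree.esize_forestRead s.1 s.2.1 s.2.2.1 s.2.2.2).trans ?_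
      rw [Polynomial.eval_mul, Polynomial.eval_X, Polynomial.eval_ofNat]
      have := esize_mk (A := A) s.1 s.2
      simp only [Prod.mk.eta] at *
      omega
  exact twigNode (cond (same (treeLabel hf) hz) noLabel (treeLabel hf))
    (comp h (pair (treeChildren hf) (pair hy (pair hz child))))

end Comp

/-! ## Addresses in queries and trees -/

section

variable {A : Type u}

namespace Twig

/-- The subquery at an address together with the kind of the edge that leads to it. -/
def walk (x : Axis × Twig A) (p : List ℕ) : Option (Axis × Twig A) :=
  p.foldlM (fun y i => y.2.children[i]?) x

/-- The root counts as reached by a child edge. -/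
abbrev edgeTo (q : Twig A) (p : List ℕ) : Option (Axis × Twig A) := walk (.child, q) p

theorem walk_nil (x : Axis × Twig A) : walk x [] = some x := rfl

theorem walk_cons (x : Axis × Twig A) (i : ℕ) (p : List ℕ) :
    walk x (i :: p) = x.2.children[i]?.bind fun y => walk y p := rfl

theorem walk_append (x : Axis × Twig A) (p p' : List ℕ) :
    walk x (p ++ p') = (walk x p).bind fun y => walk y p' := List.foldlM_append

theorem walk_snoc (x : Axis × Twig A) (p : List ℕ) (i : ℕ) :
    walk x (p ++ [i]) = (walk x p).bind fun y => y.2.children[i]? := by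
  simp [walk_append, walk_cons, walk_nil]

theorem walk_of_prefix {x : Axis × Twig A} {p p' : List ℕ} (h : p <+: p')
    (h' : (walk x p').isSome) : (walk x p).isSome := by
  obtain ⟨w, rfl⟩ := h
  rw [walk_append] at h'
  cases h : walk x p <;> simp_all

theorem subAt_eq_walk (k : Axis) (q : Twig A) (p : List ℕ) :
    q.subAt p = (walk (k, q) p).map Prod.snd := by
  induction p generalizing k q with
  | nil => cases q; rfl
  | cons i p ih =>
    obtain ⟨l, cs⟩ := q
    rw [walk_cons, subAt, children]
    cases h : cs[i]? with
    | none => rfl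
    | some c => exact ih c.1 c.2

theorem mem_forestNodes {L : List (Axis × Twig A)} {p : List ℕ} {i : ℕ} {x : NodeRec A} :
    x ∈ forestNodes L p i ↔ ∃ j w c d, L[j]? = some c ∧ walk c w = some d ∧
      x = (p ++ (i + j) :: w, d.1, d.2.label) := by
  induction L using forest_induction generalizing p i with
  | nil => simp [forestNodes]
  | cons k l cs rest ih1 ih2 =>
    rw [forestNodes, List.mem_cons, List.mem_append, ih1, ih2]
    constructor
    · rintro (rfl | ⟨j, w, c, d, h1, h2, rfl⟩ | ⟨j, w, c, d, h1, h2, rfl⟩)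
      · exact ⟨0, [], (k, node l cs), _, rfl, rfl, rfl⟩
      · refine ⟨0, j :: w, (k, node l cs), d, rfl, ?_, by simp⟩
        simp [walk_cons, children, h1, h2]
      · exact ⟨j + 1, w, c, d, h1, h2, by rw [Nat.add_right_comm, Nat.add_assoc]⟩
    · rintro ⟨j, w, c, d, h1, h2, rfl⟩
      cases j with
      | succ j => exact .inr (.inr ⟨j, w, c, d, h1, h2, by rw [Nat.add_right_comm, Nat.add_assoc]⟩)
      | zero =>
        obtain rfl : (k, node l cs) = c := by simpa using h1
        cases w with
        | nil => cases h2; exact .inl rfl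
        | cons j w =>
          rw [walk_cons] at h2
          obtain ⟨c, h3, h4⟩ := Option.bind_eq_some_iff.1 h2
          exact .inr (.inl ⟨j, w, c, d, h3, h4, by simp⟩)

theorem mem_nodes {q : Twig A} {x : NodeRec A} :
    x ∈ q.nodes ↔ ∃ d, q.edgeTo x.1 = some d ∧ x.2 = (d.1, d.2.label) := by
  rw [nodes, List.mem_cons, mem_forestNodes]
  constructor
  · rintro (rfl | ⟨j, w, c, d, h1, h2, rfl⟩)
    · exact ⟨_, rfl, rfl⟩
    · exact ⟨d, by simp [edgeTo, walk_cons, h1, h2], rfl⟩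
  · rintro ⟨d, h1, h2⟩
    obtain ⟨p, k, l⟩ := x
    cases p with
    | nil => cases h1; exact .inl (by simpa using h2)
    | cons j w =>
      obtain ⟨c, h3, h4⟩ := Option.bind_eq_some_iff.1 h1
      exact .inr ⟨j, w, c, d, h3, h4, by simpa using h2⟩

theorem exists_mem_nodes {q : Twig A} {p : List ℕ} {d : Axis × Twig A} (h : q.edgeTo p = some d) :
    (p, d.1, d.2.label) ∈ q.nodes := mem_nodes.2 ⟨d, h, rfl⟩

theorem edge_iff {q : Twig A} {k : Axis} {n n' : q.Node} :
    q.Edge k n n' ↔ ∃ i c, n'.1 = n.1 ++ [i] ∧ q.edgeTo (n.1 ++ [i]) = some (k, c) := by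
  obtain ⟨n, hn⟩ := n
  have h := subAt_eq_walk .child q n
  simp only [Edge, edgeTo, walk_snoc]
  cases h1 : walk (.child, q) n with
  | none => rw [h1] at h; simp [h] at hn
  | some d => simp [h, h1]

theorem lab_eq {q : Twig A} {n : q.Node} {d : Axis × Twig A} (h : q.edgeTo n.1 = some d) :
    q.lab n = d.2.label := by
  have := subAt_eq_walk .child q n.1
  rw [edgeTo] at h
  simp only [lab, this, h, Option.map_some, Option.get_some]

theorem isSome_subAt {q : Twig A} {p : List ℕ} :
    (q.subAt p).isSome = (q.edgeTo p).isSome := by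
  rw [subAt_eq_walk .child]; simp

theorem exists_edgeTo {q : Twig A} (n : q.Node) : ∃ d, q.edgeTo n.1 = some d :=
  Option.isSome_iff_exists.1 (isSome_subAt ▸ n.2)

theorem isLeaf_iff {q : Twig A} {n : q.Node} {d : Axis × Twig A} (h : q.edgeTo n.1 = some d) :
    q.IsLeaf n ↔ d.2.children = [] := by
  simp only [IsLeaf, edge_iff]
  constructor
  · intro h1
    by_contra h2
    obtain ⟨c, cs, h3⟩ := List.exists_cons_of_ne_nil h2
    have h4 : q.edgeTo (n.1 ++ [0]) = some c := by
      rw [edgeTo] at h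
      simp [edgeTo, walk_snoc, h, h3]
    exact h1 c.1 ⟨n.1 ++ [0], by rw [isSome_subAt, h4]; rfl⟩ ⟨0, c.2, rfl, h4⟩
  · rintro h1 k n' ⟨i, c, -, h2⟩
    rw [edgeTo] at h
    simp [edgeTo, walk_snoc, h, h1] at h2

end Twig

namespace LTree

theorem subAt_snoc (t : LTree A) (p : List ℕ) (i : ℕ) :
    t.subAt (p ++ [i]) = (t.subAt p).bind fun s => s.children[i]? := by
  induction p generalizing t with
  | nil =>
    obtain ⟨a, ts⟩ := t
    simp only [List.nil_append, subAt, Option.bind_some, children]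
    cases ts[i]? <;> simp
  | cons j p ih =>
    obtain ⟨a, ts⟩ := t
    rw [List.cons_append, subAt, subAt]
    cases h : ts[j]? with
    | none => rfl
    | some s => exact ih s

/-- From here on, proper descendants are proper extensions of addresses, and paths in trees are
handled as lists. -/
theorem transGen_child_iff {t : LTree A} {n n' : t.Node} :
    Relation.TransGen t.Child n n' ↔ n.1 <+: n'.1 ∧ n.1 ≠ n'.1 := by
  constructor
  · intro h
    induction h with
    | single h => obtain ⟨i, hi⟩ := h; rw [hi]; simp
    | tail _ h ih =>
      obtain ⟨i, hi⟩ := h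
      rw [hi]
      refine ⟨ih.1.trans (List.prefix_append _ _), fun h => ?_⟩
      have := ih.1.length_le
      rw [h] at this
      simp at this
  · obtain ⟨p, hp⟩ := n
    obtain ⟨p', hp'⟩ := n'
    rintro ⟨⟨w, rfl⟩, h⟩
    induction w using List.reverseRecOn with
    | nil => simp at h
    | append_singleton w i ih =>
      have h1 : (t.subAt (p ++ w)).isSome := by
        rw [← List.append_assoc, subAt_snoc] at hp'
        cases h : t.subAt (p ++ w) <;> simp_all
      have h2 : t.Child ⟨p ++ w, h1⟩ ⟨p ++ (w ++ [i]), hp'⟩ := ⟨i, (List.append_assoc _ _ _).symm⟩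
      by_cases hw : w = []
      · subst hw
        refine .single ?_
        simpa using h2
      · exact .tail (ih h1 (by simpa using hw)) h2

variable [LinearOrder A]

/-- A tree as a query without wildcards and descendant edges. -/
abbrev toTwig (t : LTree A) : Twig A := t.read none none

theorem forestRead_none (ts : List (LTree A)) :
    forestRead ts none none .child = ts.map fun t => (.child, t.toTwig) := by
  have h : ∀ a : A, sameLab (some a) none = false := fun a => rfl
  induction ts with
  | nil => rw [forestRead]; rfl
  | cons t ts ih =>
    obtain ⟨a, us⟩ := t
    rw [forestRead, ih]
    simp only [h, cond_false, List.map_cons]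
    rfl

theorem toTwig_label (t : LTree A) : t.toTwig.label = some t.label := rfl

theorem toTwig_children (t : LTree A) :
    t.toTwig.children = t.children.map fun t => (.child, t.toTwig) := forestRead_none _

theorem edgeTo_toTwig (t : LTree A) (p : List ℕ) :
    t.toTwig.edgeTo p = (t.subAt p).map fun s => (.child, s.toTwig) := by
  induction p using List.reverseRecOn with
  | nil => cases t; rfl
  | append_singleton p i ih =>
    rw [Twig.edgeTo] at ih
    rw [Twig.edgeTo, Twig.walk_snoc, subAt_snoc, ih]
    cases t.subAt p with
    | none => rfl
    | some s => simp [toTwig_children]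

end LTree

/-! ## Homomorphisms -/

/-- `g` maps addresses of `q` to addresses of `t` in such a way that it is a homomorphism of
queries that maps the node `s` to the node `s'`. -/
structure IsHom (q : Twig A) (s : List ℕ) (t : Twig A) (s' : List ℕ) (g : List ℕ → List ℕ) :
    Prop where
  root : g [] = []
  sel : g s = s'
  node : ∀ p x, q.edgeTo p = some x →
    ∃ y, t.edgeTo (g p) = some y ∧ ∀ a, x.2.label = some a → y.2.label = some a
  child : ∀ p i c, q.edgeTo (p ++ [i]) = some (.child, c) →
    ∃ j d, g (p ++ [i]) = g p ++ [j] ∧ t.edgeTo (g p ++ [j]) = some (.child, d)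
  desc : ∀ p i c, q.edgeTo (p ++ [i]) = some (.desc, c) →
    g p <+: g (p ++ [i]) ∧ g p ≠ g (p ++ [i])

def Hom (q : Twig A) (s : List ℕ) (t : Twig A) (s' : List ℕ) : Prop := ∃ g, IsHom q s t s' g

namespace IsHom

variable {q t : Twig A} {s s' : List ℕ} {g : List ℕ → List ℕ}

theorem prefix_step (h : IsHom q s t s' g) {p : List ℕ} {i : ℕ}
    (hi : (q.edgeTo (p ++ [i])).isSome) : g p <+: g (p ++ [i]) ∧ g p ≠ g (p ++ [i]) := by
  obtain ⟨⟨k, c⟩, hc⟩ := Option.isSome_iff_exists.1 hi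
  cases k with
  | desc => exact h.desc p i c hc
  | child =>
    obtain ⟨j, d, h1, -⟩ := h.child p i c hc
    rw [h1]
    simp

/-- Every edge lengthens the image address by at least one. Hence homomorphisms preserve proper
descendants, which makes them compose, and do not decrease depth. -/
theorem prefix_append (h : IsHom q s t s' g) (p w : List ℕ)
    (hw : (q.edgeTo (p ++ w)).isSome) :
    g p <+: g (p ++ w) ∧ (g p).length + w.length ≤ (g (p ++ w)).length := by
  induction w using List.reverseRecOn with
  | nil => simp
  | append_singleton w i ih =>
    rw [← List.append_assoc] at hw ⊢
    have h1 := ih (Twig.walk_of_prefix (List.prefix_append _ _) hw)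
    have h2 := h.prefix_step hw
    refine ⟨h1.1.trans h2.1, ?_⟩
    have h3 : (g (p ++ w)).length ≠ (g (p ++ w ++ [i])).length :=
      fun h => h2.2 (h2.1.eq_of_length h)
    have h4 := h2.1.length_le
    rw [List.length_append, List.length_singleton]
    omega

theorem strict_prefix (h : IsHom q s t s' g) {p p' : List ℕ} (h1 : p <+: p') (h2 : p ≠ p')
    (h3 : (q.edgeTo p').isSome) : g p <+: g p' ∧ g p ≠ g p' := by
  obtain ⟨w, rfl⟩ := h1
  have h4 := h.prefix_append p w h3
  refine ⟨h4.1, fun h5 => h2 ?_⟩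
  rw [← h5] at h4
  have : w = [] := List.length_eq_zero_iff.1 (by omega)
  simp [this]

theorem length_le (h : IsHom q s t s' g) {p : List ℕ} (hp : (q.edgeTo p).isSome) :
    p.length ≤ (g p).length := by
  have := (h.prefix_append [] p hp).2
  rw [List.nil_append] at this
  omega

theorem comp {t' : Twig A} {s'' : List ℕ} {g' : List ℕ → List ℕ} (h' : IsHom t s' t' s'' g')
    (h : IsHom q s t s' g) : IsHom q s t' s'' fun p => g' (g p) where
  root := by rw [h.root, h'.root]
  sel := by rw [h.sel, h'.sel]
  node p x hx := by
    obtain ⟨y, h1, h2⟩ := h.node p x hx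
    obtain ⟨z, h3, h4⟩ := h'.node _ y h1
    exact ⟨z, h3, fun a ha => h4 a (h2 a ha)⟩
  child p i c hc := by
    obtain ⟨j, d, h1, h2⟩ := h.child p i c hc
    rw [h1]
    exact h'.child _ j d h2
  desc p i c hc := by
    obtain ⟨h1, h2⟩ := h.desc p i c hc
    obtain ⟨y, h3, -⟩ := h.node _ _ hc
    exact h'.strict_prefix h1 h2 (by rw [h3]; rfl)

end IsHom

theorem Hom.trans {q t t' : Twig A} {s s' s'' : List ℕ} (h : Hom q s t s') (h' : Hom t s' t' s'') :
    Hom q s t' s'' :=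
  let ⟨_, h⟩ := h
  let ⟨_, h'⟩ := h'
  ⟨_, h'.comp h⟩

theorem mem_lang_iff [LinearOrder A] {q : UTwig A} {t : DecTree A} :
    t ∈ q.lang ↔ Hom q.twig q.sel.1 t.tree.toTwig t.sel.1 := by
  constructor
  · rintro ⟨f, hf⟩
    classical
    -- The value at addresses that are not nodes is irrelevant: the conditions in `IsHom` concern
    -- existing nodes only.
    let g (p : List ℕ) : List ℕ := if h : (q.twig.subAt p).isSome then (f ⟨p, h⟩).1 else []
    have hg : ∀ p (h : (q.twig.subAt p).isSome), g p = (f ⟨p, h⟩).1 := fun p h => dif_pos h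
    have val : ∀ p x, q.twig.edgeTo p = some x → (q.twig.subAt p).isSome := fun p x h => by
      rw [Twig.isSome_subAt, h]; rfl
    have pre : ∀ p i x, q.twig.edgeTo (p ++ [i]) = some x → (q.twig.subAt p).isSome :=
      fun p i x h => by
        rw [Twig.isSome_subAt]
        exact Twig.walk_of_prefix (List.prefix_append _ _) (by rw [Option.isSome_iff_exists]; exact ⟨x, h⟩)
    refine ⟨g, (hg [] (by simp [Twig.subAt])).trans (congrArg Subtype.val hf.root),
      (hg _ q.sel.2).trans (congrArg Subtype.val hf.sel), fun p x hx => ?_, fun p i c hc => ?_,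
      fun p i c hc => ?_⟩
    · have h := val p x hx
      obtain ⟨y, hy⟩ := Option.isSome_iff_exists.1 (f ⟨p, h⟩).2
      refine ⟨(.child, y.toTwig), by rw [hg p h, LTree.edgeTo_toTwig, hy]; rfl, fun a ha => ?_⟩
      have h1 := hf.lab ⟨p, h⟩ a ((Twig.lab_eq (n := ⟨p, h⟩) hx).trans ha)
      rw [LTree.toTwig_label, ← h1]
      simp only [LTree.lab, hy, Option.get_some]
    · have h := val _ _ hc
      obtain ⟨j, hj⟩ := hf.child ⟨p, pre p i _ hc⟩ ⟨p ++ [i], h⟩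
        (Twig.edge_iff.2 ⟨i, c, rfl, hc⟩)
      rw [← hg, ← hg p] at hj
      obtain ⟨y, hy⟩ := Option.isSome_iff_exists.1 (f ⟨p ++ [i], h⟩).2
      exact ⟨j, y.toTwig, hj, by rw [← hj, hg _ h, LTree.edgeTo_toTwig, hy]; rfl⟩
    · have h := val _ _ hc
      have h1 := LTree.transGen_child_iff.1 (hf.desc ⟨p, pre p i _ hc⟩ ⟨p ++ [i], h⟩
        (Twig.edge_iff.2 ⟨i, c, rfl, hc⟩))
      rwa [← hg, ← hg] at h1
  · rintro ⟨g, hg⟩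
    have val : ∀ n : q.twig.Node, (t.tree.subAt (g n.1)).isSome := fun n => by
      obtain ⟨d, hd⟩ := Twig.exists_edgeTo n
      obtain ⟨y, hy, -⟩ := hg.node _ _ hd
      rw [LTree.edgeTo_toTwig] at hy
      cases h : t.tree.subAt (g n.1) <;> simp_all
    refine ⟨fun n => ⟨g n.1, val n⟩, Subtype.ext hg.root, fun n n' h => ?_, fun n n' h => ?_,
      fun n a ha => ?_, Subtype.ext hg.sel⟩
    · obtain ⟨i, c, h1, h2⟩ := Twig.edge_iff.1 h
      obtain ⟨j, d, h3, -⟩ := hg.child _ i c h2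
      exact ⟨j, by simp only [h1, h3]⟩
    · obtain ⟨i, c, h1, h2⟩ := Twig.edge_iff.1 h
      refine LTree.transGen_child_iff.2 ?_
      simp only [h1]
      exact hg.desc _ i c h2
    · obtain ⟨d, hd⟩ := Twig.exists_edgeTo n
      obtain ⟨y, hy, h1⟩ := hg.node _ _ hd
      rw [LTree.edgeTo_toTwig] at hy
      obtain ⟨z, h2, rfl⟩ := Option.map_eq_some_iff.1 hy
      have h3 := h1 a ((Twig.lab_eq hd).symm.trans ha)
      simp only [LTree.lab, h2, Option.get_some]
      simpa [LTree.toTwig_label] using h3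

/-! ## A local form of path-subsumption-freeness -/

/-- Conditions on the single edges of a query that are equivalent to path-subsumption-freeness. -/
def LocallyPsf (q : Twig A) (s : List ℕ) : Prop :=
  ∀ p i x k y, q.edgeTo p = some x → q.edgeTo (p ++ [i]) = some (k, y) →
    (k = .desc → x.2.label = none → p <+: s ∧ (p ++ [i] <+: s → p = [])) ∧
    (k = .desc → y.label = none → p ++ [i] = s ∨ (¬ p ++ [i] <+: s ∧ y.children = [])) ∧
    (k = .child → y.label = none → p ++ [i] <+: s ∨ y.children ≠ [])

/-- The definition of path-subsumption-freeness speaks about paths to leaves; this puts every edge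
on such a path. -/
theorem Twig.exists_walk_leaf (L : List (Axis × Twig A)) :
    ∀ c ∈ L, ∃ w y, walk c w = some y ∧ y.2.children = [] := by
  induction L using forest_induction with
  | nil => simp
  | cons k l cs rest ih1 ih2 =>
    intro c hc
    rcases List.mem_cons.1 hc with rfl | hc
    · cases cs with
      | nil => exact ⟨[], _, rfl, rfl⟩
      | cons d cs =>
        obtain ⟨w, y, h1, h2⟩ := ih1 d (by simp)
        exact ⟨0 :: w, y, by simp [walk_cons, children, h1], h2⟩
    · exact ih2 c hc

/-- Applied to the selecting node and a node `v`, this yields the branch node of `v`. -/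
theorem exists_greatest_common_prefix (s v : List ℕ) :
    ∃ u, u <+: s ∧ u <+: v ∧ ∀ w, w <+: s → w <+: v → w <+: u := by
  induction s generalizing v with
  | nil => exact ⟨[], by simp, by simp, fun w h _ => h⟩
  | cons a s ih =>
    cases v with
    | nil => exact ⟨[], by simp, by simp, fun w _ h => h⟩
    | cons b v =>
      by_cases hab : a = b
      · subst hab
        obtain ⟨u, h1, h2, h3⟩ := ih v
        refine ⟨a :: u, by simpa using h1, by simpa using h2, fun w h4 h5 => ?_⟩
        cases w with
        | nil => simp
        | cons c w =>
          rw [List.cons_prefix_cons] at h4 h5 ⊢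
          exact ⟨h4.1, h3 w h4.2 h5.2⟩
      · refine ⟨[], by simp, by simp, fun w h4 h5 => ?_⟩
        cases w with
        | nil => simp
        | cons c w =>
          rw [List.cons_prefix_cons] at h4 h5
          exact absurd (h4.1.symm.trans h5.1) hab

theorem snoc_not_prefix_self (p : List ℕ) (i : ℕ) : ¬ p ++ [i] <+: p := fun h => by
  have := h.length_le
  simp at this

theorem snoc_prefix_of_ne {p u v : List ℕ} {i : ℕ} (hu : u <+: v) (hp : p ++ [i] <+: v)
    (h : ¬ u <+: p) : p ++ [i] <+: u := by
  rcases List.prefix_or_prefix_of_prefix hu hp with h1 | h1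
  · rcases List.prefix_concat_iff.1 h1 with h2 | h2
    · rw [h2]
    · exact absurd h2 h
  · exact h1

/-- An edge on the selecting path is governed by the anchoring of that path. Any other edge can be
extended to a leaf and then lies below the branch node of that leaf, on a path that is anchored in
the Boolean sense. On such a path only the branch node and the leaf may be wildcards incident to
descendant edges, and these two are recognised locally: the branch node is on the selecting path,
the leaf has no children. -/
theorem UTwig.isPsf_iff {q : UTwig A} : q.IsPsf ↔ LocallyPsf q.twig q.sel.1 := by
  constructor
  · rintro ⟨h1, h2⟩ p i x k y hx hy
    have hn : (q.twig.subAt p).isSome := by rw [Twig.isSome_subAt, hx]; rfl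
    have hn' : (q.twig.subAt (p ++ [i])).isSome := by rw [Twig.isSome_subAt, hy]; rfl
    have he : q.twig.Edge k ⟨p, hn⟩ ⟨p ++ [i], hn'⟩ := Twig.edge_iff.2 ⟨i, y, rfl, hy⟩
    have lx : q.twig.lab ⟨p, hn⟩ = x.2.label := Twig.lab_eq hx
    have ly : q.twig.lab ⟨p ++ [i], hn'⟩ = y.label :=
      Twig.lab_eq (n := ⟨p ++ [i], hn'⟩) hy
    -- The branch node `u` of `v` lies at or above the upper end of the edge, since otherwise the
    -- lower end would be on the selecting path too.
    have off : ¬ p ++ [i] <+: q.sel.1 → ∀ (v : q.twig.Node), p ++ [i] <+: v.1 → q.twig.IsLeaf v →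
        ∃ u : q.twig.Node, u.1 <+: q.sel.1 ∧ u.1 <+: p ∧ q.twig.AnchoredBoolean u v := by
      intro h3 v h4 h5
      obtain ⟨u, h6, h7, h8⟩ := exists_greatest_common_prefix q.sel.1 v.1
      have hu : (q.twig.subAt u).isSome := by
        rw [Twig.isSome_subAt]
        exact Twig.walk_of_prefix h7 (by rw [← Twig.edgeTo, ← Twig.isSome_subAt]; exact v.2)
      refine ⟨⟨u, hu⟩, h6, ?_, h2 ⟨u, hu⟩ v h5 (fun h => h3 (h ▸ h4))
        ⟨h6, h7, fun w h9 h10 => h8 w.1 h9 h10⟩⟩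
      by_contra h9
      exact h3 ((snoc_prefix_of_ne h7 h4 h9).trans h6)
    obtain ⟨w, z, hw, hz⟩ := Twig.exists_walk_leaf [(k, y)] (k, y) (by simp)
    have hv : q.twig.edgeTo (p ++ [i] ++ w) = some z := by
      rw [Twig.edgeTo] at hy ⊢
      rw [Twig.walk_append, hy]
      exact hw
    let v : q.twig.Node := ⟨p ++ [i] ++ w, by rw [Twig.isSome_subAt, hv]; rfl⟩
    have hleaf : q.twig.IsLeaf v := (Twig.isLeaf_iff hv).2 hz
    have hpv : p ++ [i] <+: v.1 := List.prefix_append _ _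
    refine ⟨?_, ?_, ?_⟩
    · rintro rfl h3
      by_cases h4 : p ++ [i] <+: q.sel.1
      · exact ⟨(List.prefix_append _ _).trans h4, fun _ => congrArg Subtype.val
          ((h1 ⟨p, hn⟩ ⟨p ++ [i], hn'⟩ List.nil_prefix h4 he).1 (lx.trans h3))⟩
      · obtain ⟨u, h5, h6, h7⟩ := off h4 v hpv hleaf
        have := (h7.1 ⟨p, hn⟩ ⟨p ++ [i], hn'⟩ h6 hpv he).1 (lx.trans h3)
        exact ⟨by rw [← this] at h5; exact h5, fun h => absurd h h4⟩
    · rintro rfl h3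
      by_cases h4 : p ++ [i] <+: q.sel.1
      · exact .inl (congrArg Subtype.val ((h1 ⟨p, hn⟩ ⟨p ++ [i], hn'⟩ List.nil_prefix h4 he).2 (ly.trans h3)))
      · obtain ⟨u, h5, h6, h7⟩ := off h4 v hpv hleaf
        have := (h7.1 ⟨p, hn⟩ ⟨p ++ [i], hn'⟩ h6 hpv he).2 (ly.trans h3)
        rw [← this] at hleaf
        exact .inr ⟨h4, (Twig.isLeaf_iff hy).1 hleaf⟩
    · rintro rfl h3
      -- Here the lower end of the edge is itself the leaf, so the path to it violates the Boolean
      -- condition on its last edge.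
      by_contra! h4
      obtain ⟨u, h5, h6, h7⟩ := off h4.1 ⟨p ++ [i], hn'⟩ List.prefix_rfl
        ((Twig.isLeaf_iff hy).2 h4.2)
      exact h7.2 (ly.trans h3) ⟨p, hn⟩ h6 he
  · intro h
    have key : ∀ (k : Axis) (n n' : q.twig.Node), q.twig.Edge k n n' →
        ∃ (i : ℕ) (y : List (Axis × Twig A)), n'.1 = n.1 ++ [i] ∧
        (k = .desc → q.twig.lab n = none → n.1 <+: q.sel.1 ∧ (n'.1 <+: q.sel.1 → n.1 = [])) ∧
        (k = .desc → q.twig.lab n' = none →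
          n'.1 = q.sel.1 ∨ (¬ n'.1 <+: q.sel.1 ∧ y = [])) ∧
        (k = .child → q.twig.lab n' = none → n'.1 <+: q.sel.1 ∨ y ≠ []) ∧
        (q.twig.IsLeaf n' ↔ y = []) := by
      intro k n n' he
      obtain ⟨i, y, h1, h2⟩ := Twig.edge_iff.1 he
      obtain ⟨x, hx⟩ := Twig.exists_edgeTo n
      refine ⟨i, y.children, h1, ?_⟩
      have h3 := h _ i x k y hx h2
      rw [← h1] at h3 h2
      rw [Twig.lab_eq hx, Twig.lab_eq h2, Twig.isLeaf_iff h2]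
      exact ⟨h3.1, h3.2.1, h3.2.2, Iff.rfl⟩
    refine ⟨fun n n' _ h2 he => ?_, fun u v h1 h2 h3 => ⟨fun n n' h4 h5 he => ?_, fun h4 n h5 he => ?_⟩⟩
    · obtain ⟨i, y, h3, h4, h5, -⟩ := key _ _ _ he
      refine ⟨fun h6 => Subtype.ext ((h4 rfl h6).2 h2), fun h6 => Subtype.ext ?_⟩
      rcases h5 rfl h6 with h7 | h7
      · exact h7
      · exact absurd h2 h7.1
    · obtain ⟨i, y, h6, h7, h8, -, h9⟩ := key _ _ _ he
      have h10 : n.1 <+: v.1 := (h6 ▸ List.prefix_append _ _ : n.1 <+: n'.1).trans h5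
      refine ⟨fun h11 => ?_, fun h11 => ?_⟩
      · have h12 := h3.2.2 n (h7 rfl h11).1 h10
        exact Subtype.ext (h12.eq_of_length_le h4.length_le)
      · rcases h8 rfl h11 with h12 | h12
        · have h13 : n'.1 <+: u.1 := h3.2.2 n' (by rw [UTwig.OnSelPath, Twig.AncOrSelf, h12]) h5
          have h14 := h13.trans h4
          rw [h6] at h14
          exact absurd h14 (snoc_not_prefix_self _ _)
        · obtain ⟨w, hw⟩ := h5
          obtain ⟨x, hx⟩ := Twig.exists_edgeTo n'
          obtain ⟨z, hz⟩ := Twig.exists_edgeTo v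
          have h13 := (Twig.isLeaf_iff hx).1 (h9.2 h12.2)
          refine Subtype.ext ?_
          rw [← hw, Twig.edgeTo, Twig.walk_append] at hz
          rw [Twig.edgeTo] at hx
          rw [hx, Option.bind_some] at hz
          cases w with
          | nil => simpa using hw
          | cons j w => simp [Twig.walk_cons, h13] at hz
    · obtain ⟨i, y, h6, -, -, h7, h8⟩ := key _ _ _ he
      rcases h7 rfl h4 with h9 | h9
      · have h10 := (h3.2.2 v h9 List.prefix_rfl).trans h5
        rw [h6] at h10
        exact absurd h10 (snoc_not_prefix_self _ _)
      · exact h9 (h8.1 h1)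

end

/-! ## Canonical trees of queries -/

section

variable {A : Type u}

namespace Twig

theorem size_node (l : Option A) (cs : List (Axis × Twig A)) :
    (node l cs).size = 1 + (cs.map fun c => c.2.size).sum := by
  rw [size]

theorem length_lt_size {k : Axis} {q : Twig A} {p : List ℕ} {d : Axis × Twig A}
    (h : walk (k, q) p = some d) : p.length < q.size := by
  induction p generalizing k q with
  | nil => cases q; rw [size_node, List.length_nil]; omega
  | cons i p ih =>
    obtain ⟨l, cs⟩ := q
    rw [walk_cons] at h
    obtain ⟨c, h1, h2⟩ := Option.bind_eq_some_iff.1 h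
    have h3 := ih h2
    have h4 : c.2.size ≤ (cs.map fun c => c.2.size).sum :=
      List.le_sum_of_mem (List.mem_map_of_mem (List.mem_of_getElem? h1))
    rw [size_node, List.length_cons]
    omega

end Twig

/-- `t` below a path of `n` nodes with the label `y`. -/
def LTree.chain (y : A) (t : LTree A) : ℕ → LTree A
  | 0 => t
  | n + 1 => .node y [chain y t n]

/-- The number of nodes that replace an edge if descendant edges are replaced by `N` nodes. -/
def Axis.gap (N : ℕ) : Axis → ℕ
  | child => 0
  | desc => N

namespace Twig

def forestCanon (N : ℕ) (y z : A) : List (Axis × Twig A) → List (LTree A)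
  | [] => []
  | (k, node l cs) :: rest =>
    .chain y (.node (l.getD z) (forestCanon N y z cs)) (k.gap N) :: forestCanon N y z rest

/-- The canonical tree of a query: wildcards are replaced by the label `z`, and descendant edges
by paths with `N` inner nodes that are labelled `y`. -/
def canon (N : ℕ) (y z : A) (q : Twig A) : LTree A :=
  .node (q.label.getD z) (forestCanon N y z q.children)

theorem forestCanon_eq_map (N : ℕ) (y z : A) (L : List (Axis × Twig A)) :
    forestCanon N y z L = L.map fun c => .chain y (c.2.canon N y z) (c.1.gap N) := by
  induction L with
  | nil => rw [forestCanon]; rfl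
  | cons c L ih => obtain ⟨k, l, cs⟩ := c; rw [forestCanon, ih]; rfl

/-- The address in the canonical tree of a node of the query. -/
def lift (N : ℕ) : Twig A → List ℕ → List ℕ
  | _, [] => []
  | q, i :: p =>
    match q.children[i]? with
    | none => i :: p
    | some c => i :: (List.replicate (c.1.gap N) 0 ++ lift N c.2 p)

theorem lift_snoc {N : ℕ} {k : Axis} {q : Twig A} {p : List ℕ} {i : ℕ} {c : Axis × Twig A}
    (h : walk (k, q) (p ++ [i]) = some c) :
    lift N q (p ++ [i]) = lift N q p ++ i :: List.replicate (c.1.gap N) 0 := by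
  induction p generalizing k q with
  | nil =>
    have : q.children[i]? = some c := by simpa [walk_cons, walk_nil] using h
    simp [lift, this]
  | cons j p ih =>
    rw [List.cons_append, walk_cons] at h
    obtain ⟨d, h1, h2⟩ := Option.bind_eq_some_iff.1 h
    simp only [] at h1
    simp [lift, h1, ih h2]

/-- `Pos q N a p j`: the node of the canonical tree at the address `a` lies `j` steps above the
image of the node `p` of the query, inside the path that replaces the edge to `p`. -/
inductive Pos (q : Twig A) (N : ℕ) : List ℕ → List ℕ → ℕ → Prop
  | root : Pos q N [] [] 0
  | down {a p : List ℕ} {i : ℕ} {c : Axis × Twig A} : Pos q N a p 0 →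
      q.edgeTo (p ++ [i]) = some c → Pos q N (a ++ [i]) (p ++ [i]) (c.1.gap N)
  | chain {a p : List ℕ} {j : ℕ} : Pos q N a p (j + 1) → Pos q N (a ++ [0]) p j

namespace Pos

variable {q : Twig A} {N : ℕ} {a b p p' : List ℕ} {i j j' : ℕ}

theorem nil_inv (h : Pos q N [] p j) : p = [] ∧ j = 0 := by
  generalize ha : ([] : List ℕ) = a at h
  cases h with
  | root => exact ⟨rfl, rfl⟩
  | down => simp at ha
  | chain => simp at ha

theorem snoc_inv (h : Pos q N (a ++ [i]) p j) :
    (∃ p₀ c, p = p₀ ++ [i] ∧ Pos q N a p₀ 0 ∧ q.edgeTo (p₀ ++ [i]) = some c ∧ j = c.1.gap N) ∨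
      Pos q N a p (j + 1) := by
  generalize hb : a ++ [i] = b at h
  cases h with
  | root => simp at hb
  | down h h' =>
    obtain ⟨rfl, hi⟩ := List.append_inj' hb rfl
    cases hi
    exact .inl ⟨_, _, rfl, h, h', rfl⟩
  | chain h =>
    obtain ⟨rfl, -⟩ := List.append_inj' hb rfl
    exact .inr h

/-- With `exists_of_subAt`, every node of the canonical tree belongs to exactly one node of the
query. This gives a projection that sends the inner nodes of a path to the lower end of the path. -/
theorem unique (h : Pos q N a p j) (h' : Pos q N a p' j') : p = p' ∧ j = j' := by
  induction a using List.reverseRecOn generalizing p p' j j' with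
  | nil =>
    obtain ⟨rfl, rfl⟩ := h.nil_inv
    obtain ⟨rfl, rfl⟩ := h'.nil_inv
    exact ⟨rfl, rfl⟩
  | append_singleton a i ih =>
    rcases h.snoc_inv with ⟨p₀, c, rfl, h1, h2, rfl⟩ | h1 <;>
      rcases h'.snoc_inv with ⟨p₁, d, rfl, h3, h4, rfl⟩ | h3
    · obtain ⟨rfl, -⟩ := ih h1 h3
      rw [h2] at h4
      cases h4
      exact ⟨rfl, rfl⟩
    · have := (ih h1 h3).2; omega
    · have := (ih h1 h3).2; omega
    · obtain ⟨rfl, h⟩ := ih h1 h3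
      exact ⟨rfl, by omega⟩

theorem subAt (h : Pos q N a p j) (y z : A) : ∃ c, q.edgeTo p = some c ∧
    (q.canon N y z).subAt a = some (.chain y (c.2.canon N y z) j) := by
  induction h with
  | root => exact ⟨_, rfl, by simp [LTree.subAt, LTree.chain]⟩
  | @down a p i c h h' ih =>
    obtain ⟨d, h1, h2⟩ := ih
    refine ⟨c, h', ?_⟩
    rw [edgeTo] at h1
    rw [edgeTo, walk_snoc, h1, Option.bind_some] at h'
    rw [LTree.subAt_snoc, h2, Option.bind_some, LTree.chain, canon, LTree.children,
      forestCanon_eq_map, List.getElem?_map, h']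
    rfl
  | @chain a p j h ih =>
    obtain ⟨d, h1, h2⟩ := ih
    exact ⟨d, h1, by rw [LTree.subAt_snoc, h2]; rfl⟩

theorem exists_of_subAt {y z : A} {s : LTree A} (h : (q.canon N y z).subAt a = some s) :
    ∃ p j, Pos q N a p j := by
  induction a using List.reverseRecOn generalizing s with
  | nil => exact ⟨_, _, .root⟩
  | append_singleton a i ih =>
    rw [LTree.subAt_snoc] at h
    obtain ⟨s', h1, h2⟩ := Option.bind_eq_some_iff.1 h
    obtain ⟨p, j, h3⟩ := ih h1
    obtain ⟨c, h4, h5⟩ := h3.subAt y z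
    rw [h1] at h5
    cases h5
    cases j with
    | zero =>
      rw [LTree.chain, canon, LTree.children, forestCanon_eq_map, List.getElem?_map] at h2
      obtain ⟨d, h6, -⟩ := Option.map_eq_some_iff.1 h2
      rw [edgeTo] at h4
      exact ⟨_, _, .down (c := d) h3 (by rw [edgeTo, walk_snoc, h4]; exact h6)⟩
    | succ j =>
      have hi : i = 0 := by
        by_contra hi
        obtain ⟨i, rfl⟩ := Nat.exists_eq_succ_of_ne_zero hi
        simp [LTree.chain, LTree.children] at h2
      exact ⟨p, j, hi ▸ h3.chain⟩

theorem append_replicate (h : Pos q N a p j) : Pos q N (a ++ List.replicate j 0) p 0 := by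
  induction j generalizing a with
  | zero => simpa using h
  | succ j ih => simpa [List.replicate_succ] using ih h.chain

theorem lift {c : Axis × Twig A} (h : q.edgeTo p = some c) : Pos q N (q.lift N p) p 0 := by
  induction p using List.reverseRecOn generalizing c with
  | nil => exact .root
  | append_singleton p i ih =>
    obtain ⟨d, hd⟩ := Option.isSome_iff_exists.1
      (walk_of_prefix (x := (.child, q)) (List.prefix_append p [i]) (by rw [← edgeTo, h]; rfl))
    have := ((ih hd).down h).append_replicate
    rwa [List.append_assoc, List.singleton_append, ← lift_snoc h] at this

theorem of_zero (h : Pos q 0 a p j) : j = 0 ∧ a.length = p.length := by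
  induction h with
  | root => exact ⟨rfl, rfl⟩
  | @down _ _ _ c _ _ ih => exact ⟨by cases c.1 <;> rfl, by simp [ih.2]⟩
  | chain _ ih => omega

/-- The projection preserves proper descendants if the upper node is the image of a query node. The
lower node may be inside a path, since it is moved further down. -/
theorem strict_prefix (h : Pos q N a p 0) (h' : Pos q N b p' j) (hab : a <+: b) (hne : a ≠ b) :
    p <+: p' ∧ p ≠ p' := by
  induction b using List.reverseRecOn generalizing p' j with
  | nil => exact absurd (List.prefix_nil.1 hab) hne
  | append_singleton b i ih =>
    rcases List.prefix_concat_iff.1 hab with h1 | h1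
    · exact absurd h1 hne
    · by_cases h2 : a = b
      · subst h2
        rcases h'.snoc_inv with ⟨p₀, c, rfl, h3, -, -⟩ | h3
        · obtain ⟨rfl, -⟩ := h.unique h3
          simp
        · have := (h.unique h3).2; omega
      · rcases h'.snoc_inv with ⟨p₀, c, rfl, h3, -, -⟩ | h3
        · have h4 := ih h3 h1 h2
          refine ⟨h4.1.trans (List.prefix_append _ _), fun h5 => ?_⟩
          rw [h5] at h4
          exact snoc_not_prefix_self _ _ h4.1
        · exact ih h3 h1 h2

end Pos

theorem size_forestCanon (N : ℕ) (y z : A) (L : List (Axis × Twig A)) :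
    ((forestCanon N y z L).map LTree.size).sum ≤ (L.map fun c => c.2.size).sum * (N + 1) := by
  have chain : ∀ (t : LTree A) n, (LTree.chain y t n).size = t.size + n := by
    intro t n
    induction n with
    | zero => rfl
    | succ n ih => rw [LTree.chain, LTree.size]; simp [ih]; omega
  induction L using forest_induction with
  | nil => simp [forestCanon]
  | cons k l cs rest ih1 ih2 =>
    rw [forestCanon, List.map_cons, List.sum_cons, List.map_cons, List.sum_cons, chain, size_node,
      LTree.size, Nat.add_mul, Nat.add_mul]
    have : k.gap N ≤ N := by cases k <;> simp [Axis.gap]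
    omega

theorem size_canon (N : ℕ) (y z : A) (q : Twig A) : (q.canon N y z).size ≤ q.size * (N + 1) := by
  have := size_forestCanon N y z [(.child, q)]
  obtain ⟨l, cs⟩ := q
  simpa [canon, label, children, forestCanon, LTree.chain, Axis.gap] using this

variable [LinearOrder A]

omit [LinearOrder A] in
theorem canon_label (N : ℕ) (y z : A) (q : Twig A) :
    (q.canon N y z).label = q.label.getD z := rfl

theorem hom_canon (N : ℕ) (y z : A) (q : Twig A) (s : List ℕ) :
    Hom q s (q.canon N y z).toTwig (q.lift N s) := by
  have sub : ∀ p c, q.edgeTo p = some c →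
      (q.canon N y z).toTwig.edgeTo (q.lift N p) = some (.child, (c.2.canon N y z).toTwig) := by
    intro p c h
    obtain ⟨d, h1, h2⟩ := (Pos.lift (N := N) h).subAt y z
    rw [h] at h1
    cases h1
    rw [LTree.edgeTo_toTwig, h2]
    rfl
  refine ⟨q.lift N, rfl, rfl, fun p x hx => ⟨_, sub p x hx, fun a ha => ?_⟩, fun p i c hc => ?_,
    fun p i c hc => ?_⟩
  · rw [LTree.toTwig_label, canon_label, ha]; rfl
  · have h := sub _ _ hc
    rw [lift_snoc hc] at h ⊢
    exact ⟨i, _, rfl, h⟩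
  · rw [lift_snoc hc]; simp

/-! ## Characteristic samples -/

/-- A path-subsumption-free query that embeds in two canonical trees of `q`, one of them with
fresh labels and with long paths for the descendant edges, has a homomorphism to `q`. -/
theorem hom_of_hom_canon {q q' : Twig A} {s s' : List ℕ} {N : ℕ} {y z z' : A}
    (psf : LocallyPsf q' s') (hs' : (q'.edgeTo s').isSome) (hs : (q.edgeTo s).isSome)
    (hN : q.size ≤ N)
    (fresh : ∀ p c, q.edgeTo p = some c → c.2.label ≠ some y ∧ c.2.label ≠ some z)
    (hy : z' ≠ y) (hz : z' ≠ z)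
    (h₀ : Hom q' s' (q.canon 0 y z').toTwig (q.lift 0 s))
    (h₁ : Hom q' s' (q.canon N y z).toTwig (q.lift N s)) : Hom q' s' q s := by
  obtain ⟨f, hf⟩ := h₀
  obtain ⟨g, hg⟩ := h₁
  have pos : ∀ {M : ℕ} {u : A} {g : List ℕ → List ℕ} {s₁ : List ℕ} {p : List ℕ} {x : Axis × Twig A},
      IsHom q' s' (q.canon M y u).toTwig s₁ g → q'.edgeTo p = some x → ∃ P j c, Pos q M (g p) P j ∧
        q.edgeTo P = some c ∧ ∀ a, x.2.label = some a →
          (LTree.chain y (c.2.canon M y u) j).label = a := by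
    intro M u g s₁ p x hg hx
    obtain ⟨y', h1, h2⟩ := hg.node p x hx
    rw [LTree.edgeTo_toTwig] at h1
    obtain ⟨t, h3, rfl⟩ := Option.map_eq_some_iff.1 h1
    obtain ⟨P, j, h4⟩ := Pos.exists_of_subAt h3
    obtain ⟨c, h5, h6⟩ := h4.subAt y u
    rw [h3] at h6
    cases h6
    exact ⟨P, j, c, h4, h5, fun a ha => by simpa [LTree.toTwig_label] using h2 a ha⟩
  -- The labels of the first tree are labels of `q` or `z'`; paths with the label `y` are absent
  -- because `N = 0` there.
  have labels : ∀ p x a, q'.edgeTo p = some x → x.2.label = some a → a ≠ y ∧ a ≠ z := by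
    intro p x a hx ha
    obtain ⟨P, j, c, h1, h2, h3⟩ := pos hf hx
    obtain ⟨rfl, -⟩ := h1.of_zero
    have h4 := h3 a ha
    rw [LTree.chain, canon_label] at h4
    have h5 := fresh P c h2
    cases hc : c.2.label with
    | none => rw [hc] at h4; cases h4; exact ⟨hy, hz⟩
    | some b =>
      rw [hc] at h4 h5
      cases h4
      exact ⟨fun h => h5.1 (congrArg some h), fun h => h5.2 (congrArg some h)⟩
  -- The first tree is no deeper than `q`, and the depth of `q` is smaller than its number of nodes.
  have depth : ∀ p, (q'.edgeTo p).isSome → p.length < N := by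
    intro p hp
    obtain ⟨x, hx⟩ := Option.isSome_iff_exists.1 hp
    obtain ⟨P, j, c, h1, h2, -⟩ := pos hf hx
    have h3 := hf.length_le hp
    have h4 := length_lt_size h2
    have h5 := h1.of_zero.2
    omega
  -- `ρ` is the embedding in the second tree followed by the projection to `q`, and `r p` is the
  -- distance from the image of `p` down to the projected node. The aim is to show that `ρ` is a
  -- homomorphism.
  have : ∀ p, ∃ P j, ∀ x, q'.edgeTo p = some x → Pos q N (g p) P j := by
    intro p
    cases h : q'.edgeTo p with
    | none => exact ⟨[], 0, fun x hx => by simp at hx⟩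
    | some x =>
      obtain ⟨P, j, -, h1, -⟩ := pos hg h
      exact ⟨P, j, fun _ _ => h1⟩
  choose ρ r hρ using this
  have real_of_label : ∀ p x a, q'.edgeTo p = some x → x.2.label = some a → r p = 0 := by
    intro p x a hx ha
    obtain ⟨P, j, c, h1, h2, h3⟩ := pos hg hx
    rw [((hρ p x hx).unique h1).2]
    have h4 := h3 a ha
    cases j with
    | zero => rfl
    | succ j => exact absurd h4.symm (labels p x a hx ha).1
  have real_root : r [] = 0 := by
    have := hρ [] _ rfl
    rw [hg.root] at this
    exact this.nil_inv.2
  obtain ⟨xs', hxs'⟩ := Option.isSome_iff_exists.1 hs'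
  obtain ⟨xs, hxs⟩ := Option.isSome_iff_exists.1 hs
  have pos_sel : ρ s' = s ∧ r s' = 0 := by
    have := hρ s' _ hxs'
    rw [hg.sel] at this
    exact this.unique (Pos.lift hxs)
  have parent : ∀ p i k c, q'.edgeTo (p ++ [i]) = some (k, c) →
      ∃ x, q'.edgeTo p = some x ∧ x.2.children ≠ [] := by
    intro p i k c h
    rw [edgeTo, walk_snoc] at h
    obtain ⟨x, h1, h2⟩ := Option.bind_eq_some_iff.1 h
    exact ⟨x, h1, fun h3 => by simp [h3] at h2⟩
  -- The nodes that are not good are the wildcard leaves off the selecting path. Only these may land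
  -- strictly inside a `y`-path.
  let Good (p : List ℕ) (x : Twig A) : Prop := p <+: s' ∨ x.label ≠ none ∨ x.children ≠ []
  have wild : ∀ p x, q'.edgeTo p = some x → r p ≠ 0 → x.2.label = none ∧ p ≠ s' ∧ p ≠ [] := by
    intro p x hx hr
    refine ⟨?_, fun h => hr (h ▸ pos_sel.2), fun h => hr (h ▸ real_root)⟩
    cases h : x.2.label with
    | none => rfl
    | some a => exact absurd (real_of_label p x a hx h) hr
  -- A good wildcard inside a `y`-path is neither root nor selecting node, so no descendant edge
  -- leads to it. Its parent is good as well and lies one step higher, and this repeats up to the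
  -- top of the path, where `r` equals `N` at depth at least one.
  have above : ∀ p x, q'.edgeTo p = some x → Good p x.2 → r p ≠ 0 → N + 1 ≤ r p + p.length := by
    intro p
    induction p using List.reverseRecOn with
    | nil => intro x _ _ h; exact absurd real_root h
    | append_singleton p i ih =>
      rintro ⟨k, c⟩ hc good hr
      obtain ⟨x, hx, hch⟩ := parent p i k c hc
      obtain ⟨w1, w2, -⟩ := wild _ _ hc hr
      obtain ⟨-, h1, -⟩ := psf p i x k c hx hc
      cases k with
      | desc =>
        rcases h1 rfl w1 with h2 | h2
        · exact absurd h2 w2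
        · rcases good with h3 | h3 | h3
          · exact absurd h3 h2.1
          · exact absurd w1 h3
          · exact absurd h2.2 h3
      | child =>
        obtain ⟨j, d, h2, -⟩ := hg.child p i c hc
        have h3 := hρ _ _ hc
        rw [h2] at h3
        rw [List.length_append, List.length_singleton]
        rcases h3.snoc_inv with ⟨p₀, e, -, -, -, h4⟩ | h4
        · have : e.1.gap N ≤ N ∧ (e.1.gap N = 0 ∨ e.1.gap N = N) := by cases e.1 <;> simp [Axis.gap]
          omega
        · have h5 := ((hρ p x hx).unique h4).2
          have := ih x hx (.inr (.inr hch)) (by omega)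
          omega
  -- A good wildcard inside a `y`-path has a good child along a child edge: the next node on the
  -- selecting path if there is one, else its first child. A descendant edge is excluded because it
  -- could leave a wildcard on the selecting path only at the root or towards a branch.
  have down : ∀ p x, q'.edgeTo p = some x → Good p x.2 → r p ≠ 0 →
      ∃ i c, q'.edgeTo (p ++ [i]) = some (.child, c) ∧ Good (p ++ [i]) c := by
    intro p x hx good hr
    obtain ⟨w1, w2, w3⟩ := wild _ _ hx hr
    by_cases hp : p <+: s'
    · obtain ⟨w, hw⟩ := hp
      cases w with
      | nil => exact absurd (by simpa using hw) w2
      | cons i w =>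
        have h1 : p ++ [i] <+: s' := ⟨w, by simpa using hw⟩
        obtain ⟨⟨k, c⟩, hc⟩ := Option.isSome_iff_exists.1 (walk_of_prefix h1 hs')
        cases k with
        | desc => exact absurd (((psf p i x .desc c hx hc).1 rfl w1).2 h1) w3
        | child => exact ⟨i, c, hc, .inl h1⟩
    · have h1 : x.2.children ≠ [] := by
        rcases good with h | h | h
        · exact absurd h hp
        · exact absurd w1 h
        · exact h
      obtain ⟨⟨k, c⟩, cs, h2⟩ := List.exists_cons_of_ne_nil h1
      have hc : q'.edgeTo (p ++ [0]) = some (k, c) := by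
        rw [edgeTo] at hx
        rw [edgeTo, walk_snoc, hx, Option.bind_some, h2]
        rfl
      obtain ⟨h3, -, h4⟩ := psf p 0 x k c hx hc
      cases k with
      | desc => exact absurd (h3 rfl w1).1 hp
      | child =>
        refine ⟨0, c, hc, ?_⟩
        by_cases h5 : c.label = none
        · exact (h4 rfl h5).imp_right .inr
        · exact .inr (.inl h5)
  have below : ∀ n p x, q'.edgeTo p = some x → Good p x.2 → r p = n + 1 →
      ∃ w, (q'.edgeTo (p ++ w)).isSome ∧ n + 1 ≤ w.length := by
    intro n
    induction n with
    | zero =>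
      intro p x hx good hr
      obtain ⟨i, c, hc, -⟩ := down p x hx good (by omega)
      exact ⟨[i], by rw [hc]; rfl, le_rfl⟩
    | succ n ih =>
      intro p x hx good hr
      obtain ⟨i, c, hc, good'⟩ := down p x hx good (by omega)
      obtain ⟨j, d, h2, -⟩ := hg.child p i c hc
      have h3 := hρ _ _ hc
      rw [h2] at h3
      rcases h3.snoc_inv with ⟨p₀, e, -, h4, -, -⟩ | h4
      · have := ((hρ p x hx).unique h4).2; omega
      · have h5 := ((hρ p x hx).unique h4).2
        obtain ⟨w, h6, h7⟩ := ih _ _ hc good' (by omega)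
        exact ⟨i :: w, by simpa using h6, by simpa using h7⟩
  -- Climbing and descending together give a branch of `q'` of length more than `N`, against
  -- `depth`.
  have real : ∀ p x, q'.edgeTo p = some x → Good p x.2 → r p = 0 := by
    intro p x hx good
    by_contra hr
    obtain ⟨n, hn⟩ := Nat.exists_eq_succ_of_ne_zero hr
    obtain ⟨w, h1, h2⟩ := below n p x hx good hn
    have h3 := above p x hx good hr
    have h4 := depth _ h1
    rw [List.length_append] at h4
    omega
  have real_parent : ∀ p i k c, q'.edgeTo (p ++ [i]) = some (k, c) → Pos q N (g p) (ρ p) 0 := by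
    intro p i k c hc
    obtain ⟨x, hx, hch⟩ := parent p i k c hc
    have := hρ p x hx
    rwa [real p x hx (.inr (.inr hch))] at this
  refine ⟨ρ, ?_, pos_sel.1, fun p x hx => ?_, fun p i c hc => ?_, fun p i c hc => ?_⟩
  · have := hρ [] _ rfl
    rw [hg.root] at this
    exact this.nil_inv.1
  · obtain ⟨P, j, c, h1, h2, h3⟩ := pos hg hx
    obtain ⟨h4, h5⟩ := (hρ p x hx).unique h1
    refine ⟨c, h4 ▸ h2, fun a ha => ?_⟩
    have h6 := h3 a ha
    rw [← h5, real_of_label p x a hx ha, LTree.chain, canon_label] at h6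
    cases hc : c.2.label with
    | none => rw [hc] at h6; exact absurd h6.symm (labels p x a hx ha).2
    | some b => rw [hc] at h6; cases h6; rfl
  · have hpos := real_parent p i _ c hc
    obtain ⟨x, hx, -⟩ := parent p i _ c hc
    -- A wildcard leaf off the selecting path is never reached by a child edge, so both ends of a
    -- child edge have real images.
    have good : Good (p ++ [i]) c := by
      by_cases h5 : c.label = none
      · exact ((psf p i x .child c hx hc).2.2 rfl h5).imp_right .inr
      · exact .inr (.inl h5)
    have h1 := hρ _ _ hc
    obtain ⟨j, d, h2, -⟩ := hg.child p i c hc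
    rw [h2, real _ _ hc good] at h1
    rcases h1.snoc_inv with ⟨p₀, ⟨k, e⟩, h3, h4, h5, h6⟩ | h3
    · obtain ⟨rfl, -⟩ := hpos.unique h4
      -- The images are adjacent and the lower one is at distance 0 from its projection. A
      -- descendant edge of `q` would put it at distance `N`, which is positive.
      have hk : k = .child := by
        cases k with
        | child => rfl
        | desc =>
          have := length_lt_size h5
          simp only [Axis.gap] at h6
          omega
      subst hk
      exact ⟨j, e, h3, h5⟩
    · have := (hpos.unique h3).2; omega
  · have h1 := hg.desc p i c hc
    exact (real_parent p i _ c hc).strict_prefix (hρ _ _ hc) h1.1 h1.2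

/-! ## Reading a query off its canonical tree -/

theorem forestRead_chain {y a : A} (hy : a ≠ y) (z : Option A) (us rest : List (LTree A)) (n : ℕ)
    (k : Axis) : LTree.forestRead (.chain y (.node a us) n :: rest) (some y) z k =
      ((if n = 0 then k else .desc), (LTree.node a us).read (some y) z) ::
        LTree.forestRead rest (some y) z k := by
  induction n generalizing k rest with
  | zero =>
    have : sameLab (some a) (some y) = false := by
      rw [← Bool.not_eq_true, sameLab_iff]; simpa using hy.symm
    rw [LTree.chain, LTree.forestRead, this]
    rfl
  | succ n ih =>
    have : sameLab (some y) (some y) = true := sameLab_iff.2 ⟨y, rfl, rfl⟩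
    rw [LTree.chain, LTree.forestRead, this, cond_true, ih, LTree.forestRead]
    simp

/-- Freshness makes the label `y` occur on path nodes only and `z` on former wildcards only, so
reading undoes the construction exactly. `N ≠ 0` is needed because a path without inner nodes would
be read as a child edge. `Y` and `Z` may be `none` when there is nothing to undo. -/
theorem forestRead_forestCanon {N : ℕ} (hN : N ≠ 0) {y z : A} (hyz : z ≠ y) {Y Z : Option A}
    (hY : Y = none ∨ Y = some y) (hZ : Z = none ∨ Z = some z) (L : List (Axis × Twig A)) :
    (∀ c ∈ L, ∀ w d, walk c w = some d → d.2.label ≠ some y ∧ d.2.label ≠ some z ∧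
      (d.1 = .desc → Y = some y) ∧ (d.2.label = none → Z = some z)) →
    LTree.forestRead (forestCanon N y z L) Y Z .child = L := by
  induction L using forest_induction with
  | nil => intro _; rw [forestCanon, LTree.forestRead]
  | cons k l cs rest ih1 ih2 =>
    intro h
    have h1 := h _ List.mem_cons_self [] _ rfl
    have ih1 := ih1 fun c hc w d hd => by
      obtain ⟨i, hi⟩ := List.mem_iff_getElem?.1 hc
      exact h _ List.mem_cons_self (i :: w) d (by simp [walk_cons, children, hi, hd])
    have ih2 := ih2 fun c hc => h c (List.mem_cons_of_mem _ hc)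
    have hl : sameLab (some (l.getD z)) Y = false := by
      rw [← Bool.not_eq_true, sameLab_iff]
      rintro ⟨c, h2, h3⟩
      rcases hY with rfl | rfl
      · cases h3
      · cases h3; cases h2
        cases l with
        | none => exact hyz rfl
        | some b => exact h1.1 rfl
    have hl' : (bif sameLab (some (l.getD z)) Z then none else some (l.getD z)) = l := by
      cases l with
      | none =>
        rw [h1.2.2.2 rfl]
        have : sameLab (some z) (some z) = true := sameLab_iff.2 ⟨z, rfl, rfl⟩
        simp [this]
      | some b =>
        have : sameLab (some b) Z = false := by
          rw [← Bool.not_eq_true, sameLab_iff]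
          rintro ⟨c, h2, h3⟩
          rcases hZ with rfl | rfl
          · cases h3
          · cases h3; cases h2; exact h1.2.1 rfl
        simp [this]
    rw [forestCanon]
    cases k with
    | child => rw [Axis.gap, LTree.chain, LTree.forestRead, hl, cond_false, hl', ih1, ih2]
    | desc =>
      obtain rfl := h1.2.2.1 rfl
      have hne : l.getD z ≠ y := by
        intro h2
        rw [h2, sameLab_iff.2 ⟨y, rfl, rfl⟩] at hl
        cases hl
      rw [Axis.gap, forestRead_chain hne, if_neg hN, LTree.read, LTree.label, LTree.children, hl',
        ih1, ih2]

theorem read_canon {N : ℕ} (hN : N ≠ 0) {y z : A} (hyz : z ≠ y) {Y Z : Option A}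
    (hY : Y = none ∨ Y = some y) (hZ : Z = none ∨ Z = some z) (q : Twig A)
    (h : ∀ p d, q.edgeTo p = some d → d.2.label ≠ some y ∧ d.2.label ≠ some z ∧
      (d.1 = .desc → Y = some y) ∧ (d.2.label = none → Z = some z)) :
    (q.canon N y z).read Y Z = q := by
  have h1 := forestRead_forestCanon hN hyz hY hZ [(.child, q)] (by simpa using h)
  obtain ⟨l, cs⟩ := q
  rw [forestCanon, Axis.gap, LTree.chain, LTree.forestRead] at h1
  cases h2 : sameLab (some (l.getD z)) Y with
  | true =>
    obtain ⟨c, h3, h4⟩ := sameLab_iff.1 h2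
    have h5 := h [] _ rfl
    rcases hY with rfl | rfl
    · cases h4
    · cases h4; cases h3
      cases l with
      | none => exact absurd rfl hyz
      | some b => exact absurd rfl h5.1
  | false =>
    rw [h2, cond_false, List.cons.injEq, Prod.mk.injEq] at h1
    exact h1.1.2

end Twig

end

/-! ## Decision procedures on lists of nodes -/

section

variable {A : Type u}

def isChildOf (p p' : List ℕ) : Bool := !p'.isEmpty && p'.dropLast == p

theorem isChildOf_iff {p p' : List ℕ} : isChildOf p p' = true ↔ ∃ i, p' = p ++ [i] := by
  induction p' using List.reverseRecOn with
  | nil => simp [isChildOf]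
  | append_singleton p' i _ => simp [isChildOf]

/-- No node of the list is a child of the address `p`. -/
def isLeafIn (N : List (NodeRec A)) (p : List ℕ) : Bool := N.all fun x => !isChildOf p x.1

def isPsf (N : List (NodeRec A)) (s : List ℕ) : Bool :=
  N.all fun m => N.all fun n => !isChildOf n.1 m.1 ||
    bif m.2.1.isDesc then
      (!n.2.2.isNone || n.1.isPrefixOf s && (!m.1.isPrefixOf s || n.1.isEmpty)) &&
        (!m.2.2.isNone || (m.1 == s || !m.1.isPrefixOf s && isLeafIn N m.1))
    else !m.2.2.isNone || (m.1.isPrefixOf s || !isLeafIn N m.1)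

theorem isLeafIn_iff {q : Twig A} {p : List ℕ} {x : Axis × Twig A} (h : q.edgeTo p = some x) :
    isLeafIn q.nodes p = true ↔ x.2.children = [] := by
  simp only [isLeafIn, List.all_eq_true, Bool.not_eq_true', ← Bool.not_eq_true, isChildOf_iff]
  rw [Twig.edgeTo] at h
  constructor
  · intro h1
    by_contra h2
    obtain ⟨c, cs, h3⟩ := List.exists_cons_of_ne_nil h2
    have h4 : q.edgeTo (p ++ [0]) = some c := by simp [Twig.edgeTo, Twig.walk_snoc, h, h3]
    exact h1 _ (Twig.exists_mem_nodes h4) ⟨0, rfl⟩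
  · rintro h1 m hm ⟨i, hi⟩
    obtain ⟨d, h2, -⟩ := Twig.mem_nodes.1 hm
    rw [hi] at h2
    simp [Twig.edgeTo, Twig.walk_snoc, h, h1] at h2

theorem isPsf_iff {q : Twig A} {s : List ℕ} : isPsf q.nodes s = true ↔ LocallyPsf q s := by
  have key : ∀ p i x k y, q.edgeTo p = some x → q.edgeTo (p ++ [i]) = some (k, y) →
      ((bif k.isDesc then
        (!x.2.label.isNone || p.isPrefixOf s && (!(p ++ [i]).isPrefixOf s || p.isEmpty)) &&
          (!y.label.isNone || (p ++ [i] == s || !(p ++ [i]).isPrefixOf s &&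
            isLeafIn q.nodes (p ++ [i])))
      else !y.label.isNone || ((p ++ [i]).isPrefixOf s || !isLeafIn q.nodes (p ++ [i]))) = true ↔
      (k = .desc → x.2.label = none → p <+: s ∧ (p ++ [i] <+: s → p = [])) ∧
      (k = .desc → y.label = none → p ++ [i] = s ∨ (¬ p ++ [i] <+: s ∧ y.children = [])) ∧
      (k = .child → y.label = none → p ++ [i] <+: s ∨ y.children ≠ [])) := by
    intro p i x k y hx hy
    have h1 := isLeafIn_iff hy
    simp only [] at h1
    cases k <;> simp only [Axis.isDesc, cond_true, cond_false, Bool.and_eq_true, Bool.or_eq_true,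
      Bool.not_eq_true', ← Bool.not_eq_true, List.isPrefixOf_iff_prefix, h1, beq_iff_eq,
      Option.isNone_iff_eq_none, List.isEmpty_iff, reduceCtorEq, false_implies, true_implies,
      true_and, and_true] <;> tauto
  simp only [isPsf, List.all_eq_true]
  constructor
  · intro h p i x k y hx hy
    have := h _ (Twig.exists_mem_nodes hy) _ (Twig.exists_mem_nodes hx)
    simp only [isChildOf_iff.2 ⟨i, rfl⟩, Bool.not_true, Bool.false_or] at this
    exact (key p i x k y hx hy).1 this
  · rintro h ⟨p', k', l'⟩ hm ⟨p, k, l⟩ hn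
    obtain ⟨⟨k', y⟩, h1, h2⟩ := Twig.mem_nodes.1 hm
    obtain ⟨x, h3, h4⟩ := Twig.mem_nodes.1 hn
    cases h2
    cases h4
    cases hc : isChildOf p p' with
    | false => rfl
    | true =>
      obtain ⟨i, hi⟩ := isChildOf_iff.1 hc
      simp only [] at hi h1 h3
      subst hi
      simp only [Bool.not_true, Bool.false_or]
      exact (key p i x k' y h3 h1).2 (h p i x k' y h3 h1)

/-- The pair of target nodes `n`, `m` can be the image of an edge of kind `k`. -/
def edgeMatches (k : Axis) (n m : NodeRec A) : Bool :=
  bif k.isDesc then n.1.isPrefixOf m.1 && !(n.1 == m.1) else isChildOf n.1 m.1 && !m.2.1.isDesc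

def nodePairs (N M : List (NodeRec A)) : List (NodeRec A × NodeRec A) :=
  N.flatMap fun x => M.map fun n => (x, n)

variable [LinearOrder A]

/-- The pairs in `P` that respect labels, roots and selected nodes and are compatible with a pair
in `R` for each child of the query node. -/
def refinePairs (N : List (NodeRec A)) (s s' : List ℕ) (P R : List (NodeRec A × NodeRec A)) :
    List (NodeRec A × NodeRec A) :=
  P.filter fun x => labMatches x.1.2.2 x.2.2.2 && (!(x.1.1 == s) || x.2.1 == s') &&
    (!x.1.1.isEmpty || x.2.1.isEmpty) &&
    N.all fun y => !isChildOf x.1.1 y.1 || R.any fun r => r.1.1 == y.1 && edgeMatches y.2.1 x.2 r.2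

/-- Every round filters the initial list `P` afresh and uses the previous round only as a supply of
witnesses. The lists thus never exceed `P`, and a pair in round `n` is supported by witnesses
through `n` levels of the query. -/
def iteratePairs (N : List (NodeRec A)) (s s' : List ℕ) (P : List (NodeRec A × NodeRec A)) :
    ℕ → List (NodeRec A × NodeRec A)
  | 0 => P
  | n + 1 => refinePairs N s s' P (iteratePairs N s s' P n)

/-- Existence of a homomorphism. The number of iterations exceeds the depth of the query. -/
def isHom (q : Twig A) (s : List ℕ) (t : Twig A) (s' : List ℕ) : Bool :=
  (iteratePairs q.nodes s s' (nodePairs q.nodes t.nodes)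
    (0 :: q.nodes.flatMap fun x => x.1).length).any fun r => r.1.1.isEmpty

omit [LinearOrder A] in
theorem mem_nodePairs {N M : List (NodeRec A)} {r : NodeRec A × NodeRec A} :
    r ∈ nodePairs N M ↔ r.1 ∈ N ∧ r.2 ∈ M := by
  obtain ⟨x, n⟩ := r
  simp [nodePairs]

theorem mem_refinePairs {N : List (NodeRec A)} {s s' : List ℕ}
    {P R : List (NodeRec A × NodeRec A)} {x n : NodeRec A} :
    (x, n) ∈ refinePairs N s s' P R ↔ (x, n) ∈ P ∧ (∀ c, x.2.2 = some c → n.2.2 = some c) ∧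
      (x.1 = s → n.1 = s') ∧ (x.1 = [] → n.1 = []) ∧
      ∀ y ∈ N, (∃ i, y.1 = x.1 ++ [i]) →
        ∃ r ∈ R, r.1.1 = y.1 ∧ edgeMatches y.2.1 n r.2 = true := by
  simp only [refinePairs, List.mem_filter, Bool.and_eq_true, labMatches_iff, Bool.or_eq_true,
    Bool.not_eq_true', ← Bool.not_eq_true, beq_iff_eq, List.isEmpty_iff, List.all_eq_true,
    isChildOf_iff, List.any_eq_true, ← imp_iff_not_or, and_assoc]

omit [LinearOrder A] in
theorem edgeMatches_child {n m : NodeRec A} :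
    edgeMatches .child n m = true ↔ (∃ j, m.1 = n.1 ++ [j]) ∧ m.2.1 = .child := by
  rw [edgeMatches, Axis.isDesc, cond_false, Bool.and_eq_true, isChildOf_iff]
  cases m.2.1 <;> simp [Axis.isDesc]

omit [LinearOrder A] in
theorem edgeMatches_desc {n m : NodeRec A} :
    edgeMatches .desc n m = true ↔ n.1 <+: m.1 ∧ n.1 ≠ m.1 := by
  simp [edgeMatches, Axis.isDesc]

/-- The graph of a homomorphism survives every round, since the images of the children are the
required witnesses. -/
theorem IsHom.mem_iteratePairs {q t : Twig A} {s s' : List ℕ} {g : List ℕ → List ℕ}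
    (h : IsHom q s t s' g) (k : ℕ) {x n : NodeRec A} (hx : x ∈ q.nodes) (hn : n ∈ t.nodes)
    (hxn : n.1 = g x.1) : (x, n) ∈ iteratePairs q.nodes s s' (nodePairs q.nodes t.nodes) k := by
  induction k generalizing x n with
  | zero => exact mem_nodePairs.2 ⟨hx, hn⟩
  | succ k ih =>
    obtain ⟨d, hd, hd'⟩ := Twig.mem_nodes.1 hx
    obtain ⟨e, he, he'⟩ := Twig.mem_nodes.1 hn
    refine mem_refinePairs.2 ⟨mem_nodePairs.2 ⟨hx, hn⟩, fun c hc => ?_, fun hs => ?_, fun hs => ?_,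
      fun y hy hyx => ?_⟩
    · obtain ⟨e', h1, h2⟩ := h.node _ d hd
      rw [← hxn, he] at h1
      cases h1
      rw [hd'] at hc
      rw [he']
      exact h2 c hc
    · rw [hxn, hs, h.sel]
    · rw [hxn, hs, h.root]
    · obtain ⟨i, hi⟩ := hyx
      obtain ⟨⟨k, c⟩, h1, h2⟩ := Twig.mem_nodes.1 hy
      obtain ⟨e', h3, -⟩ := h.node _ _ h1
      refine ⟨_, ih hy (Twig.exists_mem_nodes h3) rfl, rfl, ?_⟩
      rw [h2]
      rw [hi] at h1 h3 ⊢
      cases k with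
      | child =>
        obtain ⟨j, d', h4, h5⟩ := h.child _ _ _ h1
        rw [h4, h5] at h3
        cases h3
        exact edgeMatches_child.2 ⟨⟨j, by rw [h4, hxn]⟩, rfl⟩
      | desc =>
        refine edgeMatches_desc.2 ?_
        rw [hxn]
        exact h.desc _ _ _ h1

theorem isHom_iff {q t : Twig A} {s s' : List ℕ} (hs : (q.edgeTo s).isSome) :
    isHom q s t s' = true ↔ Hom q s t s' := by
  classical
  rw [isHom, List.any_eq_true]
  set P := nodePairs q.nodes t.nodes with hP
  set K := (0 :: q.nodes.flatMap fun x => x.1).length with hK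
  constructor
  · rintro ⟨⟨x₀, n₀⟩, h1, h2⟩
    let It := iteratePairs q.nodes s s' P
    -- From a surviving pair at the root, a homomorphism is chosen top-down: a pair in round `j + 1`
    -- offers for each child of its query node a compatible pair in round `j`.
    let Ok (j : ℕ) (p a : List ℕ) : Prop := ∃ r ∈ It j, r.1.1 = p ∧ r.2.1 = a
    let E (p a : List ℕ) (i : ℕ) (a' : List ℕ) : Prop := ∀ k c, q.edgeTo (p ++ [i]) = some (k, c) →
      (k = .child → ∃ j d, a' = a ++ [j] ∧ t.edgeTo (a ++ [j]) = some (.child, d)) ∧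
      (k = .desc → a <+: a' ∧ a ≠ a')
    have mem_P : ∀ j r, r ∈ It j → r ∈ P := by
      intro j r hr
      cases j with
      | zero => exact hr
      | succ j => exact (mem_refinePairs.1 hr).1
    have step : ∀ j p a i c, Ok (j + 1) p a → q.edgeTo (p ++ [i]) = some c →
        ∃ a', Ok j (p ++ [i]) a' ∧ E p a i a' := by
      rintro j p a i ⟨k, c⟩ ⟨⟨x, n⟩, hr, rfl, rfl⟩ hc
      obtain ⟨-, -, -, -, h4⟩ := mem_refinePairs.1 hr
      obtain ⟨⟨y, m⟩, h5, h6, h7⟩ := h4 _ (Twig.exists_mem_nodes hc) ⟨i, rfl⟩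
      refine ⟨m.1, ⟨(y, m), h5, h6, rfl⟩, fun k' c' hc' => ?_⟩
      simp only [] at hc
      rw [hc] at hc'
      cases hc'
      refine ⟨?_, ?_⟩
      · rintro rfl
        obtain ⟨⟨i', h8⟩, h9⟩ := edgeMatches_child.1 h7
        obtain ⟨⟨k', d⟩, h10, h11⟩ := Twig.mem_nodes.1 (mem_nodePairs.1 (mem_P _ _ h5)).2
        rw [h11] at h9
        cases h9
        exact ⟨i', d, h8, by rw [← h8]; exact h10⟩
      · rintro rfl
        exact edgeMatches_desc.1 h7
    -- `G` takes reversed addresses, so that list recursion passes from a node to its parent. A node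
    -- at depth `d` receives a partner from round `K - d`.
    let G : List ℕ → List ℕ := fun w => List.rec []
      (fun i w a => if h : ∃ a', Ok (K - w.length - 1) (w.reverse ++ [i]) a' ∧ E w.reverse a i a'
        then h.choose else []) w
    have depth : ∀ p x, q.edgeTo p = some x → p.length < K := by
      intro p x hx
      have h3 := (List.sublist_flatten_of_mem (List.mem_map_of_mem (f := fun x : NodeRec A => x.1)
        (Twig.exists_mem_nodes hx))).length_le
      rw [hK, List.length_cons, List.flatMap_def]
      simp only at h3
      omega
    have hG : ∀ p i c, q.edgeTo (p ++ [i]) = some c → Ok (K - p.length) p (G p.reverse) →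
        Ok (K - p.length - 1) (p ++ [i]) (G (p ++ [i]).reverse) ∧
          E p (G p.reverse) i (G (p ++ [i]).reverse) := by
      intro p i c hc hp
      have h3 := depth _ _ hc
      rw [List.length_append, List.length_singleton] at h3
      have h4 := step (K - p.length - 1) p _ i c (by rwa [show K - p.length - 1 + 1 = K - p.length by omega]) hc
      have h5 : ∃ a', Ok (K - p.reverse.length - 1) (p.reverse.reverse ++ [i]) a' ∧
          E p.reverse.reverse (G p.reverse) i a' := by
        rwa [List.reverse_reverse, List.length_reverse]
      have h6 : G (p ++ [i]).reverse = h5.choose := by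
        rw [List.reverse_append, List.reverse_singleton, List.singleton_append]
        exact dif_pos h5
      have h7 := h5.choose_spec
      rw [← h6, List.reverse_reverse, List.length_reverse] at h7
      exact h7
    have ok : ∀ p x, q.edgeTo p = some x → Ok (K - p.length) p (G p.reverse) := by
      intro p
      induction p using List.reverseRecOn with
      | nil =>
        intro x _
        have h3 : x₀.1 = [] := by simpa using h2
        obtain ⟨k, hk⟩ : ∃ k, K = k + 1 := ⟨_, rfl⟩
        have h4 : (x₀, n₀) ∈ It (k + 1) := hk ▸ h1
        exact ⟨_, h1, h3, (mem_refinePairs.1 h4).2.2.2.1 h3⟩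
      | append_singleton p i ih =>
        intro c hc
        obtain ⟨x, hx⟩ := Option.isSome_iff_exists.1
          (Twig.walk_of_prefix (x := (.child, q)) (List.prefix_append p [i])
            (by rw [← Twig.edgeTo, hc]; rfl))
        rw [List.length_append, List.length_singleton, ← Nat.sub_sub]
        exact (hG p i c hc (ih x hx)).1
    -- As `K` exceeds every depth, at least one round is left at each node, and that round enforces
    -- the conditions on labels and on the selecting node.
    have ok' : ∀ p x, q.edgeTo p = some x → (p = s → G p.reverse = s') ∧
        ∃ y, t.edgeTo (G p.reverse) = some y ∧ ∀ a, x.2.label = some a → y.2.label = some a := by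
      intro p x hx
      obtain ⟨⟨y, m⟩, h3, rfl, h5⟩ := ok p x hx
      have h6 := depth _ _ hx
      obtain ⟨k, hk⟩ := Nat.exists_eq_succ_of_ne_zero (Nat.sub_ne_zero_of_lt h6)
      rw [hk] at h3
      obtain ⟨h7, h8, h9, -, -⟩ := mem_refinePairs.1 h3
      rw [← h5]
      refine ⟨h9, ?_⟩
      obtain ⟨d, h10, h11⟩ := Twig.mem_nodes.1 (mem_nodePairs.1 h7).1
      obtain ⟨e, h12, h13⟩ := Twig.mem_nodes.1 (mem_nodePairs.1 h7).2
      simp only [] at h10 h12 h11 h13 hx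
      rw [hx] at h10
      cases h10
      rw [h11, h13] at h8
      exact ⟨e, h12, h8⟩
    have edge : ∀ p i c, q.edgeTo (p ++ [i]) = some c →
        E p (G p.reverse) i (G (p ++ [i]).reverse) := by
      intro p i c hc
      obtain ⟨x, hx⟩ := Option.isSome_iff_exists.1
        (Twig.walk_of_prefix (x := (.child, q)) (List.prefix_append p [i])
          (by rw [← Twig.edgeTo, hc]; rfl))
      exact (hG p i c hc (ok p x hx)).2
    obtain ⟨xs, hxs⟩ := Option.isSome_iff_exists.1 hs
    exact ⟨fun p => G p.reverse, rfl, (ok' s xs hxs).1 rfl, fun p x hx => (ok' p x hx).2,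
      fun p i c hc => (edge p i _ hc _ _ hc).1 rfl, fun p i c hc => (edge p i _ hc _ _ hc).2 rfl⟩
  · rintro ⟨g, hg⟩
    exact ⟨_, hg.mem_iteratePairs K (x := ([], .child, q.label)) (n := ([], .child, t.label))
      (Twig.exists_mem_nodes (q := q) (p := []) rfl) (Twig.exists_mem_nodes (q := t) (p := []) rfl)
      hg.root.symm, rfl⟩

/-! ## The learner -/

/-- Decorated trees and unary queries without the proofs that the selected nodes exist. -/
abbrev RawTree (A : Type u) : Type u := LTree A × List ℕ
abbrev RawQuery (A : Type u) : Type u := Twig A × List ℕ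

/-- The labels of a tree, and the absence of a label. -/
def labelChoices (t : LTree A) : List (Option A) := none :: t.toTwig.nodes.map fun x => x.2.2

/-- All path-subsumption-free queries that can be read off a tree, with any selected node. -/
def candidates (t : LTree A) : List (RawQuery A) :=
  (labelChoices t).flatMap fun y => (labelChoices t).flatMap fun z =>
    ((t.read y z).nodes.filter fun x => !x.1.isEmpty && isPsf (t.read y z).nodes x.1).map
      fun x => (t.read y z, x.1)

def consistentCandidates (S : List (RawTree A)) : List (RawQuery A) :=
  (S.flatMap fun t => candidates t.1).filter fun c => S.all fun t => isHom c.1 c.2 t.1.toTwig t.2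

/-- The query that selects all nodes other than the root. -/
def universalQuery : RawQuery A := (.node none [(.desc, .node none [])], [0])

/-- The least consistent candidates, followed by the universal query. -/
def bestQueries (S : List (RawTree A)) : List (RawQuery A) :=
  ((consistentCandidates S).filter fun c =>
    (consistentCandidates S).all fun d => isHom d.1 d.2 c.1 c.2) ++ [universalQuery]

omit [LinearOrder A] in
theorem esize_filter_le {α : Type*} [Enc A α] (f : α → Bool) (l : List α) :
    esize A (l.filter f) ≤ esize A l := by
  induction l with
  | nil => rfl
  | cons a l ih =>
    rw [List.filter_cons, esize_cons]
    split
    · rw [esize_cons]; omega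
    · omega

end

/-! ### Polynomial time of the decision procedures and of the learner -/

namespace Comp

variable {A : Type u} [LinearOrder A] [OrderBot A] {σ : Type*} [Enc A σ]

theorem childOf {f g : σ → List ℕ} (hf : Comp A f) (hg : Comp A g) :
    Comp A fun x => isChildOf (f x) (g x) :=
  and (not (isEmpty hg)) (addressEq (dropLast hg) hf)

theorem leafIn {N : σ → List (NodeRec A)} {p : σ → List ℕ} (hN : Comp A N) (hp : Comp A p) :
    Comp A fun x => isLeafIn (N x) (p x) :=
  all hN (not (childOf (comp hp (fst id)) (fst (snd id))))

theorem psf {N : σ → List (NodeRec A)} {s : σ → List ℕ} (hN : Comp A N) (hs : Comp A s) :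
    Comp A fun x => isPsf (N x) (s x) := by
  have hs' : Comp A fun y : (σ × NodeRec A) × NodeRec A => s y.1.1 := comp hs (fst (fst id))
  have hN' : Comp A fun y : (σ × NodeRec A) × NodeRec A => N y.1.1 := comp hN (fst (fst id))
  have m : Comp A fun y : (σ × NodeRec A) × NodeRec A => y.1.2 := snd (fst id)
  have n : Comp A fun y : (σ × NodeRec A) × NodeRec A => y.2 := snd id
  exact all hN (all (comp hN (fst id)) (or (not (childOf (fst n) (fst m)))
    (cond (isDesc (fst (snd m)))
      (and (or (not (isNone (snd (snd n)))) (and (addressPrefix (fst n) hs')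
          (or (not (addressPrefix (fst m) hs')) (isEmpty (fst n)))))
        (or (not (isNone (snd (snd m)))) (or (addressEq (fst m) hs')
          (and (not (addressPrefix (fst m) hs')) (leafIn hN' (fst m))))))
      (or (not (isNone (snd (snd m)))) (or (addressPrefix (fst m) hs')
        (not (leafIn hN' (fst m))))))))

theorem edge {k : σ → Axis} {n m : σ → NodeRec A} (hk : Comp A k) (hn : Comp A n)
    (hm : Comp A m) : Comp A fun x => edgeMatches (k x) (n x) (m x) :=
  cond (isDesc hk) (and (addressPrefix (fst hn) (fst hm)) (not (addressEq (fst hn) (fst hm))))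
    (and (childOf (fst hn) (fst hm)) (not (isDesc (fst (snd hm)))))

theorem refinement {N : σ → List (NodeRec A)} {s s' : σ → List ℕ}
    {P R : σ → List (NodeRec A × NodeRec A)} (hN : Comp A N) (hs : Comp A s) (hs' : Comp A s')
    (hP : Comp A P) (hR : Comp A R) :
    Comp A fun x => refinePairs (N x) (s x) (s' x) (P x) (R x) := by
  have r : Comp A fun y : σ × NodeRec A × NodeRec A => y.2 := snd id
  exact filter hP (and (and (and (labels (snd (snd (fst r))) (snd (snd (snd r))))
      (or (not (addressEq (fst (fst r)) (comp hs (fst id))))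
        (addressEq (fst (snd r)) (comp hs' (fst id)))))
      (or (not (isEmpty (fst (fst r)))) (isEmpty (fst (snd r)))))
    (all (comp hN (fst id)) (or (not (childOf (fst (fst (snd (fst id)))) (fst (snd id))))
      (any (comp hR (fst (fst id))) (and (addressEq (fst (fst (snd id))) (fst (snd (fst id))))
        (edge (fst (snd (snd (fst id)))) (snd (snd (fst (fst id)))) (snd (snd id))))))))

theorem iteration {N : σ → List (NodeRec A)} {s s' : σ → List ℕ}
    {P : σ → List (NodeRec A × NodeRec A)} {l : σ → List ℕ} (hN : Comp A N) (hs : Comp A s)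
    (hs' : Comp A s') (hP : Comp A P) (hl : Comp A l) :
    Comp A fun x => iteratePairs (N x) (s x) (s' x) (P x) (l x).length := by
  refine comp (g := fun y : List ℕ × σ =>
    iteratePairs (N y.2) (s y.2) (s' y.2) (P y.2) y.1.length) (list (k := fun i => i.2.2) (g := P)
    (h := fun i : (ℕ × List ℕ × σ) × List (NodeRec A × NodeRec A) =>
      refinePairs (N i.1.2.2) (s i.1.2.2) (s' i.1.2.2) (P i.1.2.2) i.2) (snd (snd id)) hP
    (refinement (comp hN (snd (snd (fst id)))) (comp hs (snd (snd (fst id))))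
      (comp hs' (snd (snd (fst id)))) (comp hP (snd (snd (fst id)))) (snd id))
    (fun x l e => ?_) (fun _ => rfl) (fun x l e => rfl) ?_) (pair hl id)
  · simp only [esize_cons]; omega
  · obtain ⟨p, hp⟩ := hP.esize_le
    refine ⟨p, fun y => ?_⟩
    have h1 : esize A (P y.2) ≤ p.eval (esize A y) :=
      (hp y.2).trans (p.eval_nat_mono (by have := esize_mk (A := A) y.1 y.2; simp only [Prod.mk.eta] at this; omega))
    cases y.1 with
    | nil => exact h1
    | cons i l => exact (esize_filter_le _ _).trans h1

theorem hom {q t : σ → Twig A} {s s' : σ → List ℕ} (hq : Comp A q) (hs : Comp A s)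
    (ht : Comp A t) (hs' : Comp A s') : Comp A fun x => isHom (q x) (s x) (t x) (s' x) :=
  any (iteration (nodes hq) hs hs'
    (flatMap (nodes hq) (map (nodes (comp ht (fst id))) (pair (snd (fst id)) (snd id))))
    (cons (constNil 0 rfl) (flatMap (nodes hq) (fst (snd id))))) (isEmpty (fst (fst (snd id))))

theorem choices {t : σ → LTree A} (ht : Comp A t) : Comp A fun x => labelChoices (t x) :=
  cons noLabel (map (nodes (read ht noLabel noLabel)) (snd (snd (snd id))))

theorem candidateList {t : σ → LTree A} (ht : Comp A t) : Comp A fun x => candidates (t x) := by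
  have hr : Comp A fun y : (σ × Option A) × Option A => (t y.1.1).read y.1.2 y.2 :=
    read (comp ht (fst (fst id))) (snd (fst id)) (snd id)
  exact flatMap (choices ht) (flatMap (choices (comp ht (fst id)))
    (map (filter (nodes hr) (and (not (isEmpty (fst (snd id))))
      (psf (nodes (comp hr (fst id))) (fst (snd id))))) (pair (comp hr (fst id)) (fst (snd id)))))

theorem consistentList {S : σ → List (RawTree A)} (hS : Comp A S) :
    Comp A fun x => consistentCandidates (S x) :=
  filter (flatMap hS (candidateList (fst (snd id)))) (all (comp hS (fst id))
    (hom (fst (snd (fst id))) (snd (snd (fst id))) (read (fst (snd id)) noLabel noLabel)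
      (snd (snd id))))

theorem bestList {S : σ → List (RawTree A)} (hS : Comp A S) : Comp A fun x => bestQueries (S x) :=
  append (filter (consistentList hS) (all (consistentList (comp hS (fst id)))
    (hom (fst (snd id)) (snd (snd id)) (fst (snd (fst id))) (snd (snd (fst id))))))
    (cons (pair (twigNode noLabel (cons (pair desc (twigNode noLabel nil)) nil))
      (cons (constNil 0 rfl) nil)) nil)

/-- The learner returns the first one of the best queries. -/
theorem learner : Comp A fun S : List (RawTree A) =>
    (Val.pair .nil (enc (bestQueries S) : Val A).fst : Val A) :=
  of_enc (pair (constNil () rfl) (comp (g := fun l : List (RawQuery A) => (enc l : Val A).fst)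
    (ofFst fun _ => rfl) (bestList id))) (fun x => x) (fun _ => rfl) fun _ => rfl

end Comp

section

variable {A : Type u}

/-! ## Sizes of representations -/

theorem LTree.size_pos (t : LTree A) : 0 < t.size := by
  cases t; rw [size]; omega

/-- Each of the `i` siblings to the left has at least one node. This pays for the unary
representation of `i` in addresses. -/
theorem LTree.add_size_le {ts : List (LTree A)} {i : ℕ} {t : LTree A} (h : ts[i]? = some t) :
    i + t.size ≤ (ts.map size).sum := by
  induction ts generalizing i with
  | nil => simp at h
  | cons s ts ih =>
    cases i with
    | zero => cases h; simp
    | succ i =>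
      have h1 := ih (i := i) (by simpa using h)
      have h2 := s.size_pos
      rw [List.map_cons, List.sum_cons]
      omega

theorem LTree.esize_forest_le (L : List (LTree A)) : esize A L ≤ 4 * (L.map size).sum + 1 := by
  induction L using forest_induction with
  | nil => rw [esize_nil]; omega
  | cons a us rest ih1 ih2 =>
    rw [esize_cons, esize_node, List.map_cons, List.sum_cons, size]
    omega

theorem esize_nat (n : ℕ) : esize A n = 2 * n + 1 := by
  induction n with
  | zero => rfl
  | succ n ih =>
    have : esize A (n + 1) = 1 + esize A n + 1 := rfl
    omega

theorem LTree.esize_address_le {t : LTree A} {p : List ℕ} (h : (t.subAt p).isSome) :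
    esize A p ≤ 2 * t.size := by
  induction p generalizing t with
  | nil => have := t.size_pos; rw [esize_nil]; omega
  | cons i p ih =>
    obtain ⟨a, ts⟩ := t
    rw [subAt] at h
    cases hs : ts[i]? with
    | none => simp [hs] at h
    | some s =>
      simp only [hs] at h
      have h1 := ih h
      have h2 := add_size_le hs
      rw [esize_cons, esize_nat, size]
      omega

def DecTree.raw (t : DecTree A) : RawTree A := (t.tree, t.sel.1)

def UTwig.raw (q : UTwig A) : RawQuery A := (q.twig, q.sel.1)

theorem DecTree.esize_raw_le (t : DecTree A) : esize A t.raw ≤ 7 * t.tree.size := by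
  have h1 := LTree.esize_address_le t.sel.2
  have h2 : esize A t.tree ≤ 4 * t.tree.size := by
    obtain ⟨⟨a, ts⟩, -, -⟩ := t
    have := LTree.esize_forest_le ts
    rw [LTree.esize_node, LTree.size]
    omega
  have h3 := t.tree.size_pos
  rw [raw, esize_mk]
  omega

theorem enc_raw_list (l : List (DecTree A)) :
    (enc (l.map DecTree.raw) : Val A) = (psfTwigOne A).encodeList l := by
  simp only [enc, LearningSetting.encodeList, List.map_map]
  rfl

theorem esize_raw_list_le (l : List (DecTree A)) :
    esize A (l.map DecTree.raw) ≤ 8 * (l.map fun t => t.tree.size).sum + 1 := by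
  induction l with
  | nil => rfl
  | cons t l ih =>
    have h1 := t.esize_raw_le
    have h2 := t.tree.size_pos
    rw [List.map_cons, esize_cons, List.map_cons, List.sum_cons]
    omega

theorem sampleSize_eq {l : List (DecTree A)} {S : Finset (DecTree A)}
    (h : (psfTwigOne A).Lists l S) :
    (psfTwigOne A).sampleSize S = (l.map fun t => t.tree.size).sum := by
  classical
  obtain ⟨h1, h2⟩ := h
  obtain rfl : S = l.toFinset := by ext t; rw [List.mem_toFinset]; exact (h2 t).symm
  exact List.sum_toFinset _ h1

theorem sampleSize_pair_le [DecidableEq (DecTree A)] (t t' : DecTree A) :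
    (psfTwigOne A).sampleSize ({t, t'} : Finset (DecTree A)) ≤ t.tree.size + t'.tree.size := by
  change ∑ x ∈ ({t, t'} : Finset (DecTree A)), x.tree.size ≤ _
  by_cases h : t = t'
  · rw [h, Finset.pair_eq_singleton, Finset.sum_singleton]
    exact Nat.le_add_left _ _
  · rw [Finset.sum_pair h]

/-! ## Correctness of the learner -/

theorem universalQuery_walk {p : List ℕ} {x : Axis × Twig A}
    (h : (universalQuery (A := A)).1.edgeTo p = some x) :
    x.2.label = none ∧ (p = [] ∨ p = [0] ∧ x = (.desc, .node none [])) := by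
  match p, h with
  | [], h => cases h; exact ⟨rfl, .inl rfl⟩
  | [0], h => cases h; exact ⟨rfl, .inr ⟨rfl, rfl⟩⟩
  | [i + 1], h => cases h
  | 0 :: j :: p, h => cases h
  | (i + 1) :: j :: p, h => cases h

def universalUTwig (A : Type u) : UTwig A where
  twig := universalQuery.1
  sel := ⟨[0], rfl⟩
  sel_ne_root h := by cases congrArg Subtype.val h

theorem universalUTwig_isPsf : (universalUTwig A).IsPsf := by
  rw [UTwig.isPsf_iff]
  intro p i x k y hx hy
  obtain ⟨-, h | ⟨h1, h2⟩⟩ := universalQuery_walk hy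
  · simp at h
  · cases h2
    cases p with
    | nil => simp_all [universalUTwig]
    | cons j p => simp at h1

variable [LinearOrder A]

/-- The selected node is not the root, hence a proper descendant of it, as the only edge of the
query demands. -/
theorem mem_lang_universalUTwig (t : DecTree A) : t ∈ (universalUTwig A).lang := by
  classical
  obtain ⟨s, hs⟩ := Option.isSome_iff_exists.1 t.sel.2
  have hne : t.sel.1 ≠ [] := fun h => t.sel_ne_root (Subtype.ext h)
  refine mem_lang_iff.2 ⟨fun p => if p = [] then [] else t.sel.1, rfl, rfl, fun p x hx => ?_,
    fun p i c hc => ?_, fun p i c hc => ?_⟩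
  · have h1 := (universalQuery_walk hx).1
    by_cases h : p = []
    · exact ⟨_, by rw [if_pos h]; rfl, fun a ha => by rw [h1] at ha; cases ha⟩
    · refine ⟨(.child, s.toTwig), ?_, fun a ha => by rw [h1] at ha; cases ha⟩
      rw [if_neg h, LTree.edgeTo_toTwig, hs]
      rfl
  · obtain ⟨-, h | ⟨-, h⟩⟩ := universalQuery_walk hc
    · simp at h
    · cases h
  · obtain ⟨-, h | ⟨h, -⟩⟩ := universalQuery_walk hc
    · simp at h
    · cases p with
      | nil => simpa using hne.symm
      | cons j p => simp at h

theorem mem_candidates {t : LTree A} {c : RawQuery A} :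
    c ∈ candidates t ↔ ∃ y ∈ labelChoices t, ∃ z ∈ labelChoices t, c.1 = t.read y z ∧
      (c.1.edgeTo c.2).isSome ∧ c.2 ≠ [] ∧ LocallyPsf c.1 c.2 := by
  obtain ⟨q, s⟩ := c
  simp only [candidates, List.mem_flatMap, List.mem_map, List.mem_filter, Bool.and_eq_true,
    isPsf_iff, Bool.not_eq_true', ← Bool.not_eq_true, List.isEmpty_iff, Prod.mk.injEq]
  constructor
  · rintro ⟨y, hy, z, hz, x, ⟨h1, h2, h3⟩, rfl, rfl⟩
    obtain ⟨d, h4, -⟩ := Twig.mem_nodes.1 h1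
    exact ⟨y, hy, z, hz, rfl, by rw [h4]; rfl, h2, h3⟩
  · rintro ⟨y, hy, z, hz, rfl, h1, h2, h3⟩
    obtain ⟨d, h4⟩ := Option.isSome_iff_exists.1 h1
    exact ⟨y, hy, z, hz, _, ⟨Twig.exists_mem_nodes h4, h2, h3⟩, rfl, rfl⟩

omit [LinearOrder A] in
/-- A raw query that represents a path-subsumption-free query. -/
theorem exists_raw_eq {c : RawQuery A} (h₁ : (c.1.edgeTo c.2).isSome) (h₂ : c.2 ≠ [])
    (h₃ : LocallyPsf c.1 c.2) : ∃ q : UTwig A, q.IsPsf ∧ q.raw = c :=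
  ⟨⟨c.1, ⟨c.2, by rwa [Twig.isSome_subAt]⟩, fun h => h₂ (congrArg Subtype.val h)⟩,
    UTwig.isPsf_iff.2 h₃, rfl⟩

theorem mem_consistentCandidates {l : List (DecTree A)} {c : RawQuery A} :
    c ∈ consistentCandidates (l.map DecTree.raw) ↔
      (∃ t ∈ l, c ∈ candidates t.tree) ∧ ∀ t ∈ l, Hom c.1 c.2 t.tree.toTwig t.sel.1 := by
  simp only [consistentCandidates, List.mem_filter, List.mem_flatMap, List.mem_map,
    exists_exists_and_eq_and, List.all_eq_true, forall_exists_index, and_imp,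
    forall_apply_eq_imp_iff₂, DecTree.raw]
  refine and_congr_right fun ⟨t, _, h⟩ => ?_
  obtain ⟨-, -, -, -, -, h1, -⟩ := mem_candidates.1 h
  simp only [isHom_iff h1]

theorem mem_bestQueries {l : List (DecTree A)} {c : RawQuery A}
    (h : c ∈ bestQueries (l.map DecTree.raw)) :
    ∃ q : UTwig A, q.IsPsf ∧ q.raw = c ∧ ∀ t ∈ l, t ∈ q.lang := by
  rcases List.mem_append.1 h with h | h
  · obtain ⟨⟨t, ht, h1⟩, h2⟩ := mem_consistentCandidates.1 (List.mem_filter.1 h).1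
    obtain ⟨-, -, -, -, -, h3, h4, h5⟩ := mem_candidates.1 h1
    obtain ⟨q, h6, rfl⟩ := exists_raw_eq h3 h4 h5
    exact ⟨q, h6, rfl, fun t ht => mem_lang_iff.2 (h2 t ht)⟩
  · obtain rfl := List.mem_singleton.1 h
    exact ⟨universalUTwig A, universalUTwig_isPsf, rfl, fun t _ => mem_lang_universalUTwig t⟩

theorem exists_head_bestQueries (S : List (RawTree A)) : ∃ c l, bestQueries S = c :: l :=
  List.exists_cons_of_ne_nil (by simp [bestQueries])

/-! ### Characteristic samples -/

/-- The canonical tree of a unary query with the image of the selecting node. -/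
def UTwig.canonTree (q : UTwig A) (N : ℕ) (y z : A) : DecTree A where
  tree := q.twig.canon N y z
  sel := ⟨q.twig.lift N q.sel.1, by
    obtain ⟨d, hd⟩ := Twig.exists_edgeTo q.sel
    obtain ⟨c, -, h⟩ := (Twig.Pos.lift (N := N) hd).subAt y z
    rw [h]
    rfl⟩
  sel_ne_root h := by
    refine q.sel_ne_root (Subtype.ext ?_)
    have h1 : q.twig.lift N q.sel.1 = [] := congrArg Subtype.val h
    obtain ⟨d, hd⟩ := Twig.exists_edgeTo q.sel
    have h2 := Twig.Pos.lift (N := N) hd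
    rw [h1] at h2
    exact h2.nil_inv.1

theorem UTwig.canonTree_mem_lang (q : UTwig A) (N : ℕ) (y z : A) : q.canonTree N y z ∈ q.lang :=
  mem_lang_iff.2 (Twig.hom_canon N y z q.twig q.sel.1)

theorem Twig.exists_fresh [Infinite A] (q : Twig A) (F : Finset A) :
    ∃ a, a ∉ F ∧ ∀ p c, q.edgeTo p = some c → c.2.label ≠ some a := by
  classical
  obtain ⟨a, ha⟩ := Infinite.exists_notMem_finset
    (F ∪ (q.nodes.filterMap fun x => x.2.2).toFinset)
  rw [Finset.mem_union, not_or, List.mem_toFinset, List.mem_filterMap] at ha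
  exact ⟨a, ha.1, fun p c hc h => ha.2 ⟨_, exists_mem_nodes hc, h⟩⟩

theorem mem_labelChoices {t : LTree A} {p : List ℕ} {s : LTree A} (h : t.subAt p = some s) :
    some s.label ∈ labelChoices t := by
  have h1 : t.toTwig.edgeTo p = some (.child, s.toTwig) := by rw [LTree.edgeTo_toTwig, h]; rfl
  exact List.mem_cons_of_mem _ (List.mem_map.2 ⟨_, Twig.exists_mem_nodes h1, rfl⟩)

/-- A query is one of the candidates that can be read off its canonical tree. -/
theorem UTwig.raw_mem_candidates {q : UTwig A} (hq : q.IsPsf) {N : ℕ} (hN : N ≠ 0) {y z : A}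
    (hyz : z ≠ y)
    (fresh : ∀ p c, q.twig.edgeTo p = some c → c.2.label ≠ some y ∧ c.2.label ≠ some z) :
    q.raw ∈ candidates (q.twig.canon N y z) := by
  classical
  obtain ⟨d, hd⟩ := Twig.exists_edgeTo q.sel
  set t := q.twig.canon N y z with ht
  -- `y` occurs in the canonical tree only if `q` has a descendant edge, and a wildcard guarantees
  -- that `z` occurs; in the remaining cases the choice `none` is the one that is always on offer.
  let Y : Option A := if ∃ p c, q.twig.edgeTo p = some (.desc, c) then some y else none
  let Z : Option A := if ∃ p c, q.twig.edgeTo p = some c ∧ c.2.label = none then some z else none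
  have hY : Y ∈ labelChoices t := by
    by_cases h : ∃ p c, q.twig.edgeTo p = some (.desc, c)
    · rw [show Y = some y from if_pos h]
      obtain ⟨p, c, h⟩ := h
      induction p using List.reverseRecOn with
      | nil => cases h
      | append_singleton p i _ =>
        obtain ⟨x, hx⟩ := Option.isSome_iff_exists.1
          (Twig.walk_of_prefix (x := (.child, q.twig)) (List.prefix_append p [i])
            (by rw [← Twig.edgeTo, h]; rfl))
        obtain ⟨e, -, h2⟩ := ((Twig.Pos.lift (N := N) hx).down h).subAt y z
        have h3 := mem_labelChoices h2
        obtain ⟨M, rfl⟩ := Nat.exists_eq_succ_of_ne_zero hN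
        exact h3
    · rw [show Y = none from if_neg h]
      exact List.mem_cons_self
  have hZ : Z ∈ labelChoices t := by
    by_cases h : ∃ p c, q.twig.edgeTo p = some c ∧ c.2.label = none
    · rw [show Z = some z from if_pos h]
      obtain ⟨p, c, h, h'⟩ := h
      obtain ⟨e, h1, h2⟩ := (Twig.Pos.lift (N := N) h).subAt y z
      rw [h] at h1
      cases h1
      have h3 := mem_labelChoices h2
      rw [LTree.chain, Twig.canon_label, h'] at h3
      exact h3
    · rw [show Z = none from if_neg h]
      exact List.mem_cons_self
  refine mem_candidates.2 ⟨Y, hY, Z, hZ, ?_, ?_, fun h => q.sel_ne_root (Subtype.ext h),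
    UTwig.isPsf_iff.1 hq⟩
  · refine (Twig.read_canon hN hyz ?_ ?_ q.twig fun p c hc => ?_).symm
    · exact (ite_eq_or_eq _ _ _).symm
    · exact (ite_eq_or_eq _ _ _).symm
    · obtain ⟨h1, h2⟩ := fresh p c hc
      exact ⟨h1, h2, fun h => if_pos ⟨p, c.2, by rw [hc, ← h]⟩, fun h => if_pos ⟨p, c, hc, h⟩⟩
  · rw [UTwig.raw, hd]; rfl

theorem UTwig.lang_eq_of_hom {q q' : UTwig A} (h : Hom q.twig q.sel.1 q'.twig q'.sel.1)
    (h' : Hom q'.twig q'.sel.1 q.twig q.sel.1) : q'.lang = q.lang := by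
  ext t
  rw [mem_lang_iff, mem_lang_iff]
  exact ⟨h.trans, h'.trans⟩

/-- If the sample contains two suitable canonical trees of `q`, then all best queries are
equivalent to `q`. -/
theorem lang_eq_of_head_bestQueries {q : UTwig A} (hq : q.IsPsf) {N : ℕ} (hN : q.twig.size ≤ N)
    {y z z' : A} (hyz : z ≠ y) (hy : z' ≠ y) (hz : z' ≠ z)
    (fresh : ∀ p c, q.twig.edgeTo p = some c → c.2.label ≠ some y ∧ c.2.label ≠ some z)
    {l : List (DecTree A)} (h₀ : q.canonTree 0 y z' ∈ l) (h₁ : q.canonTree N y z ∈ l)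
    (hl : ∀ t ∈ l, t ∈ q.lang) {q' : UTwig A} {r : List (RawQuery A)}
    (h : bestQueries (l.map DecTree.raw) = q'.raw :: r) : q'.lang = q.lang := by
  obtain ⟨d, hd⟩ := Twig.exists_edgeTo q.sel
  have hN' : N ≠ 0 := by have := Twig.length_lt_size hd; omega
  -- A consistent candidate embeds in particular in the two canonical trees, so it maps to `q`.
  have least : ∀ c ∈ consistentCandidates (l.map DecTree.raw), Hom c.1 c.2 q.twig q.sel.1 := by
    intro c hc
    obtain ⟨⟨t, -, h1⟩, h2⟩ := mem_consistentCandidates.1 hc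
    obtain ⟨-, -, -, -, -, h3, -, h4⟩ := mem_candidates.1 h1
    exact Twig.hom_of_hom_canon h4 h3 (by rw [hd]; rfl) hN fresh hy hz (h2 _ h₀) (h2 _ h₁)
  have self : q.raw ∈ consistentCandidates (l.map DecTree.raw) :=
    mem_consistentCandidates.2 ⟨⟨_, h₁, UTwig.raw_mem_candidates hq hN' hyz fresh⟩,
      fun t ht => mem_lang_iff.1 (hl t ht)⟩
  have valid : ∀ c ∈ consistentCandidates (l.map DecTree.raw), (c.1.edgeTo c.2).isSome := by
    intro c hc
    obtain ⟨⟨t, -, h1⟩, -⟩ := mem_consistentCandidates.1 hc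
    obtain ⟨-, -, -, -, -, h3, -⟩ := mem_candidates.1 h1
    exact h3
  have best : q.raw ∈ (consistentCandidates (l.map DecTree.raw)).filter fun c =>
      (consistentCandidates (l.map DecTree.raw)).all fun d => isHom d.1 d.2 c.1 c.2 :=
    List.mem_filter.2 ⟨self, List.all_eq_true.2 fun c hc => (isHom_iff (valid c hc)).2 (least c hc)⟩
  -- Since `q` is a least candidate, the head of the answer list comes from the least candidates and
  -- not from the universal query at the end.
  obtain ⟨b, bs, hb⟩ := List.exists_cons_of_ne_nil (List.ne_nil_of_mem best)
  rw [bestQueries, hb, List.cons_append, List.cons.injEq] at h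
  obtain ⟨h1, h2⟩ := List.mem_filter.1 (hb ▸ List.mem_cons_self : b ∈ _)
  rw [h.1] at h1 h2
  exact UTwig.lang_eq_of_hom
    ((isHom_iff (valid _ self)).1 (List.all_eq_true.1 h2 _ self)) (least _ h1)

end

theorem mainTheorem4 {A : Type u} [LinearOrder A] [OrderBot A] [Infinite A] :
    (psfTwigOne A).LearnableInPolyTimeAndData := by
  classical
  obtain ⟨P, p, hP⟩ := Comp.learner (A := A)
  have runs : ∀ l : List (DecTree A), ∃ n, P.Computes ((psfTwigOne A).encodeList l)
      (.pair .nil (enc (bestQueries (l.map DecTree.raw)) : Val A).fst) n ∧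
      n ≤ p.eval (8 * (l.map fun t => t.tree.size).sum + 1) := by
    intro l
    obtain ⟨n, h1, h2⟩ := hP P (l.map DecTree.raw)
    exact ⟨n, enc_raw_list l ▸ h1, h2.trans (p.eval_nat_mono (esize_raw_list_le l))⟩
  have returns : ∀ (l : List (DecTree A)) (q : {q : UTwig A // q.IsPsf}) r,
      bestQueries (l.map DecTree.raw) = q.1.raw :: r → (psfTwigOne A).Returns P l (some q) := by
    intro l q r h
    obtain ⟨n, h1, -⟩ := runs l
    rw [h] at h1
    exact ⟨n, h1⟩
  -- `8 * .X + 1` bounds the size of the input datum in terms of the sample. `2 * (.X * (.X + 1))`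
  -- accounts for two canonical trees with at most `|q| * (|q| + 1)` nodes each. The answer is never
  -- Null, hence `.inl`.
  refine ⟨P, ⟨p.comp (8 * .X + 1), fun S l _ hl => ?_⟩, fun S l _ hl => .inl ?_,
    2 * (.X * (.X + 1)), fun q => ?_⟩
  · obtain ⟨n, h1, h2⟩ := runs l
    refine ⟨_, n, h1, ?_⟩
    rw [Polynomial.eval_comp, sampleSize_eq hl]
    simpa using h2
  · obtain ⟨c, r, h⟩ := exists_head_bestQueries (l.map DecTree.raw)
    obtain ⟨q, h1, rfl, h2⟩ := mem_bestQueries (h ▸ List.mem_cons_self : c ∈ _)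
    exact ⟨⟨q, h1⟩, returns l ⟨q, h1⟩ r h, fun t ht => h2 t ((hl.2 t).2 ht)⟩
  -- `y` and `z` are distinct and do not occur in `q`. Of `z'` only the difference from both is
  -- used; it may well occur in `q`.
  · obtain ⟨y, -, hy⟩ := q.1.twig.exists_fresh ∅
    obtain ⟨z, hz, hz'⟩ := q.1.twig.exists_fresh {y}
    obtain ⟨z', hz₁, -⟩ := q.1.twig.exists_fresh {y, z}
    rw [Finset.mem_singleton] at hz
    rw [Finset.mem_insert, Finset.mem_singleton, not_or] at hz₁
    set N := q.1.twig.size with hN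
    refine ⟨{q.1.canonTree 0 y z', q.1.canonTree N y z}, Finset.insert_nonempty _ _, ?_, ?_,
      fun S l hS hq hl => ?_⟩
    · intro t ht
      rcases Finset.mem_insert.1 ht with rfl | ht
      · exact q.1.canonTree_mem_lang _ _ _
      · obtain rfl := Finset.mem_singleton.1 ht
        exact q.1.canonTree_mem_lang _ _ _
    · have h1 := Twig.size_canon 0 y z' q.1.twig
      have h2 := Twig.size_canon N y z q.1.twig
      have h3 : (psfTwigOne A).sampleSize {q.1.canonTree 0 y z', q.1.canonTree N y z} ≤
          (q.1.twig.canon 0 y z').size + (q.1.twig.canon N y z).size :=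
        sampleSize_pair_le _ _
      have h4 : q.1.twig.size * (0 + 1) ≤ N * (N + 1) := Nat.mul_le_mul_left _ (by omega)
      have h5 : (psfTwigOne A).querySize q = N := rfl
      rw [← hN] at h1 h2 h4
      rw [h5]
      simp only [Polynomial.eval_mul, Polynomial.eval_X, Polynomial.eval_add, Polynomial.eval_one,
        Polynomial.eval_ofNat]
      omega
    · obtain ⟨c, r, h⟩ := exists_head_bestQueries (l.map DecTree.raw)
      obtain ⟨q', h1, rfl, -⟩ := mem_bestQueries (h ▸ List.mem_cons_self : c ∈ _)
      exact ⟨⟨q', h1⟩, returns l ⟨q', h1⟩ r h, lang_eq_of_head_bestQueries q.2 le_rfl hz hz₁.1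
        hz₁.2 (fun p c hc => ⟨hy p c hc, hz' p c hc⟩)
        ((hl.2 _).2 (hS (Finset.mem_insert_self _ _)))
        ((hl.2 _).2 (hS (Finset.mem_insert_of_mem (Finset.mem_singleton_self _))))
        (fun t ht => hq t ((hl.2 t).1 ht)) h⟩
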